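/- **Definitions.** A hypergraph on a finite set $V$ is a set of subsets of $V$ (edges), each with at least two elements; the size of an edge is its cardinality, and the valency of a vertex is the number of edges containing it. A walk from $s$ to $f$ is a sequence $(s=v_0,e_0,v_1,\dots,e_{m-1},v_m=f)$ in which every $e_i$ is an edge containing the two distinct vertices $v_i\neq v_{i+1}$. A hypertree is a hypergraph such that for all vertices $s,f$ there is exactly one walk from $s$ to $f$ without repeated edges. Let $h_n=HT_n$ be the poset of hypertrees on $\{1,\dots,n\}$, where $T\le T'$ if the edges of $T$ are obtained by uniting edges of $T'$, that is, every edge of $T$ is a union of edges of $T'$ and every edge of $T'$ is contained in an edge of $T$; its least element is the hypertree with one edge when $n\ge 2$. Let $p_n=\Pi_n$ be the poset of partitions of $\{1,\dots,n\}$, where $P\le Q$ if every part of $P$ is a union of parts of $Q$. Let $\mathcal F$ be the smallest family of finite posets that contains all $p_i$ and $h_j$ and is closed under direct products, closed intervals $[x,y]$ and upper sets $[x,\hat 1)=\{z: x\le z\}$ (where $\hat 1$ is the added greatest element; for a poset that has a greatest element this is $[x,\hat1]$). Every poset of $\mathcal F$ has a least element $\hat 0$. The algebra $\mathcal B_{HT}$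 is the monoid algebra over $\mathbb Q$ of the monoid of isomorphism classes of posets of $\mathcal F$ under direct product (with the class of the one-point poset as unit), with the linear coproduct $\Delta:\mathcal B_{HT}\to\mathcal B_{HT}\otimes\mathcal B_{HT}$ given on isomorphism classes by $$\Delta[P]=\sum_{x\in P}\,[\hat 0,x]\otimes\{z\in P: x\le z\}.$$ A poset and its class are denoted by the same letter. **Theorem.** Let $n\ge 2$, and let $\mathcal P(n)$ be the set of pairs of finitely supported sequences of natural numbers $\alpha=(\alpha_1,\alpha_2,\dots)$ and $\pi=(\pi_2,\pi_3,\dots)$ with $$\sum_{i\ge1}\alpha_i=n,\qquad \sum_{j\ge2}(j-1)\pi_j=n-1,\qquad \sum_{i\ge1} i\,\alpha_i=n+\sum_{j\ge2}\pi_j-1 .$$ Then $\mathcal P(n)$ is finite, and in $\mathcal B_{HT}\otimes\mathcal B_{HT}$ $$\Delta(h_n)=\sum_{(\alpha,\pi)\in\mathcal P(n)}c^n_{\alpha,\pi}\;\prod_{i\ge2}p_i^{\alpha_i}\otimes\prod_{j\ge2}h_j^{\pi_j},$$ $$c^n_{\alpha,\pi}=\frac1n\cdot\frac{n!}{\prod_{j\ge2}(j-1)!^{\pi_j}\,\pi_j!}\cdot\frac{k!\;n!}{\prod_{i\ge1}(i-1)!^{\alpha_i}\,\alpha_i!},\qquad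 k=\sum_{j\ge2}\pi_j-1 .$$ Moreover, for every $(\alpha,\pi)\in\mathcal P(n)$, the number $c^n_{\alpha,\pi}$ is the number of hypertrees on $n$ vertices with $\alpha_i$ vertices of valency $i$ and $\pi_j$ edges of size $j$ for all $i\ge1$, $j\ge2$. -/

import Mathlib

open scoped TensorProduct Nat

namespace HypertreePosets

/-! ### Hypertrees -/

/-- `IsWalk E s w f`: the list `w = [(e₀, v₁), (e₁, v₂), …, (eₘ₋₁, vₘ)]` encodes a walk
`(s = v₀, e₀, v₁, e₁, …, eₘ₋₁, vₘ = f)` in the hypergraph with set of edges `E`: each `eᵢ` is an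
edge containing the two (distinct) vertices `vᵢ` and `vᵢ₊₁`. -/
def IsWalk {V : Type} (E : Finset (Finset V)) : V → List (Finset V × V) → V → Prop
  | s, [], f => s = f
  | s, (e, v) :: w, f => e ∈ E ∧ s ∈ e ∧ v ∈ e ∧ s ≠ v ∧ IsWalk E v w f

/-- A hypertree on the vertex set `V`: a hypergraph (a set of edges, each with at least two
vertices) such that between any two vertices there is exactly one walk without repeated edges. -/
@[ext]
structure Hypertree (V : Type) where
  edges : Finset (Finset V)
  two_le_card : ∀ e ∈ edges, 2 ≤ e.card
  existsUnique_walk : ∀ s f : V,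
    ∃! w : List (Finset V × V), IsWalk edges s w f ∧ (w.map Prod.fst).Nodup

namespace Hypertree

variable {V : Type}

/-- An edge containing another one is equal to it. -/
theorem eq_of_subset (T : Hypertree V) {e e' : Finset V} (he : e ∈ T.edges) (he' : e' ∈ T.edges)
    (h : e ⊆ e') : e = e' := by
  obtain ⟨s, hs, f, hf, hsf⟩ := Finset.one_lt_card.mp (T.two_le_card e he)
  have := (T.existsUnique_walk s f).unique (y₁ := [(e, f)]) (y₂ := [(e', f)])
    ⟨⟨he, hs, hf, hsf, rfl⟩, by simp⟩ ⟨⟨he', h hs, h hf, hsf, rfl⟩, by simp⟩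
  simpa using this

/-- `T ≤ T'` when the edges of `T` are obtained by uniting edges of `T'`: every edge of `T` is a
union of edges of `T'`, and every edge of `T'` lies in an edge of `T`. -/
instance [DecidableEq V] : PartialOrder (Hypertree V) where
  le T T' :=
    (∀ e ∈ T.edges, ∃ S ⊆ T'.edges, e = S.biUnion id) ∧ ∀ e' ∈ T'.edges, ∃ e ∈ T.edges, e' ⊆ e
  le_refl T := ⟨fun e he => ⟨{e}, by simpa using he, by simp⟩, fun e he => ⟨e, he, subset_rfl⟩⟩
  le_trans T₁ T₂ T₃ h₁₂ h₂₃ := by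
    refine ⟨fun e he => ?_, fun e he => ?_⟩
    · obtain ⟨S, hS, rfl⟩ := h₁₂.1 e he
      choose! F hF hF' using h₂₃.1
      refine ⟨S.biUnion F, Finset.biUnion_subset.mpr fun d hd => hF d (hS hd), ?_⟩
      rw [Finset.biUnion_biUnion]
      exact Finset.biUnion_congr rfl fun d hd => hF' d (hS hd)
    · obtain ⟨e₂, he₂, h₂⟩ := h₂₃.2 e he
      obtain ⟨e₁, he₁, h₁⟩ := h₁₂.2 e₂ he₂
      exact ⟨e₁, he₁, h₂.trans h₁⟩
  le_antisymm T T' h h' := by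
    have key : ∀ A B : Hypertree V, (∀ e' ∈ B.edges, ∃ e ∈ A.edges, e' ⊆ e) →
        (∀ e' ∈ A.edges, ∃ e ∈ B.edges, e' ⊆ e) → B.edges ⊆ A.edges := by
      intro A B hAB hBA e he
      obtain ⟨d, hd, hed⟩ := hAB e he
      obtain ⟨c, hc, hdc⟩ := hBA d hd
      have hec := B.eq_of_subset he hc (hed.trans hdc)
      have : e = d := hed.antisymm (hec ▸ hdc)
      exact this ▸ hd
    exact Hypertree.ext ((key T' T h'.2 h.2).antisymm (key T T' h.2 h'.2))

instance [Finite V] : Finite (Hypertree V) :=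
  Finite.of_injective Hypertree.edges fun _ _ h => Hypertree.ext h

/-- The valency of a vertex: the number of edges it belongs to. -/
def valency [DecidableEq V] (T : Hypertree V) (v : V) : ℕ := (T.edges.filter (v ∈ ·)).card

/-- The hypertree with no edge, on at most one vertex. -/
def empty (V : Type) [Subsingleton V] : Hypertree V where
  edges := ∅
  two_le_card := by simp
  existsUnique_walk s f := by
    refine ⟨[], ⟨Subsingleton.elim s f, by simp⟩, ?_⟩
    rintro (_ | ⟨⟨e, v⟩, w⟩) ⟨h, -⟩
    · rfl
    · exact absurd h.1 (by simp)

/-- The hypertree with only one edge, on at least two vertices. -/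
def single (V : Type) [Fintype V] [Nontrivial V] : Hypertree V where
  edges := {Finset.univ}
  two_le_card e he := by
    rw [Finset.mem_singleton.mp he, Finset.card_univ]
    exact Fintype.one_lt_card
  existsUnique_walk s f := by
    by_cases hsf : s = f
    · subst hsf
      refine ⟨[], ⟨rfl, by simp⟩, ?_⟩
      rintro (_ | ⟨⟨e, v⟩, _ | ⟨⟨e', v'⟩, w⟩⟩) ⟨h, hn⟩
      · rfl
      · exact absurd h.2.2.2.2.symm h.2.2.2.1
      · have h1 := h.1
        have h2 := h.2.2.2.2.1
        simp only [Finset.mem_singleton] at h1 h2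
        simp [h1, h2] at hn
    · refine ⟨[(Finset.univ, f)], ⟨⟨by simp, by simp, by simp, hsf, rfl⟩, by simp⟩, ?_⟩
      rintro (_ | ⟨⟨e, v⟩, _ | ⟨⟨e', v'⟩, w⟩⟩) ⟨h, hn⟩
      · exact absurd h hsf
      · have h1 := h.1
        have h2 : v = f := h.2.2.2.2
        simp only [Finset.mem_singleton] at h1
        rw [h1, h2]
      · have h1 := h.1
        have h2 := h.2.2.2.2.1
        simp only [Finset.mem_singleton] at h1 h2
        simp [h1, h2] at hn

/-- On a finite vertex set, the poset of hypertrees has a least element. -/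
theorem exists_least [Fintype V] [DecidableEq V] : ∃ b : Hypertree V, ∀ T, b ≤ T := by
  cases subsingleton_or_nontrivial V with
  | inl _ =>
    refine ⟨empty V, fun T => ⟨by simp [empty], fun e he => ?_⟩⟩
    have h1 := T.two_le_card e he
    have h2 : e.card ≤ 1 := Finset.card_le_one_of_subsingleton e
    omega
  | inr _ =>
    refine ⟨single V, fun T => ⟨fun e he => ⟨T.edges, subset_rfl, ?_⟩,
      fun e _ => ⟨Finset.univ, by simp [single], Finset.subset_univ e⟩⟩⟩
    rw [Finset.mem_singleton.mp he]
    ext s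
    obtain ⟨f, hf⟩ := exists_ne s
    obtain ⟨w, hw, -⟩ := (T.existsUnique_walk s f).exists
    rcases w with _ | ⟨⟨d, v⟩, w⟩
    · exact absurd hw.symm hf
    · simp only [Finset.mem_univ, Finset.mem_biUnion, id, true_iff]
      exact ⟨d, hw.1, hw.2.1⟩

end Hypertree

/-! ### Partition posets and hypertree posets -/

/-- Bundling a finite poset. -/
noncomputable abbrev bundle (α : Type) [PartialOrder α] [Finite α] : FinPartOrd.{0} :=
  @FinPartOrd.of α _ (Fintype.ofFinite α)

/-- The partition poset `Π_n` on the partitions of a set with `n` elements: a partition is smaller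
than another one if its parts are unions of parts of the other one, so that the partition with one
part is the least element (the reverse of Mathlib's order on `Finpartition`). -/
abbrev PartitionPoset (n : ℕ) : Type := (Finpartition (Finset.univ : Finset (Fin n)))ᵒᵈ

/-- The hypertree poset `HT_n`. -/
abbrev HypertreePoset (n : ℕ) : Type := Hypertree (Fin n)

instance (n : ℕ) : Finite (PartitionPoset n) :=
  inferInstanceAs (Finite (Finpartition (Finset.univ : Finset (Fin n))))

/-- The hereditary family generated by the partition posets and the hypertree posets: the smallest
family containing them and closed under direct products, closed intervals `[x, y]`, and half-open
intervals `[x, 1̂)` in the poset augmented with a greatest element `1̂`, that is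
`{z | x ≤ z}`. (`Π_0`, `Π_1`, `HT_0`, `HT_1`, `HT_2` are all one-point posets.) -/
inductive HTFamily : FinPartOrd.{0} → Prop
  | partition (n : ℕ) : HTFamily (bundle (PartitionPoset n))
  | hypertree (n : ℕ) : HTFamily (bundle (HypertreePoset n))
  | prod {P Q : FinPartOrd.{0}} : HTFamily P → HTFamily Q → HTFamily (bundle (P × Q))
  | Icc {P : FinPartOrd.{0}} (x y : P) (hxy : x ≤ y) : HTFamily P →
      HTFamily (bundle (Set.Icc x y))
  | Ici {P : FinPartOrd.{0}} (x : P) : HTFamily P → HTFamily (bundle (Set.Ici x))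

theorem HTFamily.exists_least {P : FinPartOrd.{0}} (h : HTFamily P) : ∃ b : P, ∀ x, b ≤ x := by
  induction h with
  | partition n =>
    classical
    have key : ∃ b : PartitionPoset n, ∀ x, b ≤ x := ⟨OrderDual.toDual ⊤, fun x =>
      OrderDual.toDual_le.mpr (le_top : OrderDual.ofDual x ≤ ⊤)⟩
    exact key
  | hypertree n => exact Hypertree.exists_least
  | prod _ _ h₁ h₂ =>
    obtain ⟨b₁, h₁⟩ := h₁
    obtain ⟨b₂, h₂⟩ := h₂
    exact ⟨(b₁, b₂), fun x => ⟨h₁ x.1, h₂ x.2⟩⟩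
  | Icc x y hxy _ _ => exact ⟨⟨x, le_rfl, hxy⟩, fun z => z.2.1⟩
  | Ici x _ _ => exact ⟨⟨x, le_rfl⟩, fun z => z.2⟩

/-- The posets of the hereditary family. -/
abbrev HTPoset : Type 1 := {P : FinPartOrd.{0} // HTFamily P}

namespace HTPoset

/-- The least element of a poset of the family. -/
noncomputable def bot (P : HTPoset) : P.1 := P.2.exists_least.choose

theorem bot_le (P : HTPoset) (x : P.1) : P.bot ≤ x := P.2.exists_least.choose_spec x

/-- The interval `[0̂, x]`. -/
noncomputable def lower (P : HTPoset) (x : P.1) : HTPoset :=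
  ⟨bundle (Set.Icc P.bot x), .Icc _ _ (P.bot_le x) P.2⟩

/-- The interval `[x, 1̂]` of `P` if `P` has a greatest element `1̂`, and the half-open interval
`[x, 1̂)` of `P` augmented with `1̂` otherwise; in both cases, it is `{z ∈ P | x ≤ z}`. -/
noncomputable def upper (P : HTPoset) (x : P.1) : HTPoset :=
  ⟨bundle (Set.Ici x), .Ici _ P.2⟩

/-- The direct product. -/
noncomputable def prod (P Q : HTPoset) : HTPoset := ⟨bundle (P.1 × Q.1), .prod P.2 Q.2⟩

/-- The trivial (one-point) poset, as the partition poset `Π_1`. -/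
noncomputable def triv : HTPoset := ⟨bundle (PartitionPoset 1), .partition 1⟩

/-- Isomorphism of posets. -/
instance setoid : Setoid HTPoset where
  r P Q := Nonempty (P.1 ≃o Q.1)
  iseqv := ⟨fun P => ⟨OrderIso.refl P.1⟩, fun ⟨e⟩ => ⟨e.symm⟩, fun ⟨e⟩ ⟨e'⟩ => ⟨e.trans e'⟩⟩

theorem lower_equiv {P Q : HTPoset} (e : P.1 ≃o Q.1) (x : P.1) : P.lower x ≈ Q.lower (e x) := by
  refine ⟨⟨e.toEquiv.subtypeEquiv fun z => ?_, e.le_iff_le⟩⟩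
  exact ⟨fun h => ⟨Q.bot_le _, e.monotone h.2⟩, fun h => ⟨P.bot_le _, e.le_iff_le.mp h.2⟩⟩

theorem upper_equiv {P Q : HTPoset} (e : P.1 ≃o Q.1) (x : P.1) : P.upper x ≈ Q.upper (e x) :=
  ⟨⟨e.toEquiv.subtypeEquiv fun _ => e.le_iff_le.symm, e.le_iff_le⟩⟩

theorem prod_equiv {P P' Q Q' : HTPoset} (h : P ≈ P') (h' : Q ≈ Q') : P.prod Q ≈ P'.prod Q' := by
  obtain ⟨e⟩ := h
  obtain ⟨e'⟩ := h'
  exact ⟨⟨e.toEquiv.prodCongr e'.toEquiv, and_congr e.le_iff_le e'.le_iff_le⟩⟩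

theorem triv_prod (P : HTPoset) : triv.prod P ≈ P := by
  have : Unique (Finpartition (Finset.univ : Finset (Fin 1))) := by
    have h : IsAtom (Finset.univ : Finset (Fin 1)) := by
      rw [Finset.univ_unique]
      exact Finset.isAtom_singleton _
    exact IsAtom.uniqueFinpartition (P := Finpartition.indiscrete h.1) h
  have key : ∀ a b : PartitionPoset 1, a ≤ b := fun a b =>
    (congrArg OrderDual.toDual (Subsingleton.elim (OrderDual.ofDual a) (OrderDual.ofDual b))).le
  refine ⟨⟨⟨fun x => x.2, fun x => (triv.bot, x), fun x => ?_, fun _ => rfl⟩, ?_⟩⟩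
  · exact Prod.ext ((key _ _).antisymm (key _ _)) rfl
  · intro a b
    exact ⟨fun h => ⟨key _ _, h⟩, fun h => h.2⟩

end HTPoset

/-- The isomorphism classes of posets of the family. -/
def HTClass : Type 1 := Quotient HTPoset.setoid

/-- The isomorphism class of a poset of the family. -/
def HTPoset.cls (P : HTPoset) : HTClass := Quotient.mk _ P

/-- The monoid of isomorphism classes; the product is induced by the direct product. -/
noncomputable instance : CommMonoid HTClass where
  mul := Quotient.map₂ HTPoset.prod fun _ _ h _ _ h' => HTPoset.prod_equiv h h'
  one := HTPoset.triv.cls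
  mul_assoc := by
    rintro ⟨P⟩ ⟨Q⟩ ⟨R⟩
    exact Quotient.sound ⟨OrderIso.prodAssoc P.1 Q.1 R.1⟩
  mul_comm := by
    rintro ⟨P⟩ ⟨Q⟩
    exact Quotient.sound ⟨(OrderIso.prodComm : P.1 × Q.1 ≃o Q.1 × P.1)⟩
  one_mul := by
    rintro ⟨P⟩
    exact Quotient.sound (HTPoset.triv_prod P)
  mul_one := by
    rintro ⟨P⟩
    have h : P.prod HTPoset.triv ≈ HTPoset.triv.prod P :=
      ⟨(OrderIso.prodComm : P.1 × HTPoset.triv.1 ≃o HTPoset.triv.1 × P.1)⟩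
    exact Quotient.sound (Setoid.trans h (HTPoset.triv_prod P))

/-! ### The bialgebra -/

/-- The algebra `B_HT`: the monoid algebra over `ℚ` of the isomorphism classes. -/
abbrev BHT : Type 1 := MonoidAlgebra ℚ HTClass

/-- The isomorphism class of a poset of the family, as an element of `B_HT`. -/
noncomputable def HTPoset.toBHT (P : HTPoset) : BHT := MonoidAlgebra.of ℚ HTClass P.cls

theorem HTPoset.toBHT_eq {P Q : HTPoset} (h : P ≈ Q) : P.toBHT = Q.toBHT :=
  congrArg (MonoidAlgebra.of ℚ HTClass) (Quotient.sound h)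

/-- The coproduct of an isomorphism class: `Δ[P] = ∑_{x ∈ P} [0̂, x] ⊗ [x, 1̂]` if `P` has a
greatest element and `Δ[P] = ∑_{x ∈ P} [0̂, x] ⊗ [x, 1̂)` otherwise. -/
noncomputable def comulClass : HTClass → BHT ⊗[ℚ] BHT :=
  Quotient.lift (fun P : HTPoset => ∑ x : P.1, (P.lower x).toBHT ⊗ₜ[ℚ] (P.upper x).toBHT) (by
    rintro P Q ⟨e⟩
    refine Fintype.sum_equiv e.toEquiv _ _ fun x => ?_
    rw [HTPoset.toBHT_eq (HTPoset.lower_equiv e x), HTPoset.toBHT_eq (HTPoset.upper_equiv e x)]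
    rfl)

/-- The coproduct of `B_HT`: the linear extension of the coproduct of isomorphism classes. -/
noncomputable def comul : BHT →ₗ[ℚ] BHT ⊗[ℚ] BHT :=
  Finsupp.linearCombination ℚ comulClass ∘ₗ (MonoidAlgebra.coeffLinearEquiv ℚ).toLinearMap

/-- The isomorphism class `p_i` of the partition poset `Π_i`. -/
noncomputable def partitionClass (i : ℕ) : BHT :=
  HTPoset.toBHT ⟨bundle (PartitionPoset i), .partition i⟩

/-- The isomorphism class `h_j` of the hypertree poset `HT_j`. -/
noncomputable def hypertreeClass (j : ℕ) : BHT :=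
  HTPoset.toBHT ⟨bundle (HypertreePoset j), .hypertree j⟩

/-! ### The index set and the coefficients -/

/-- The set `𝒫(n)` of pairs of tuples `α = (α₁, α₂, …)` and `π = (π₂, π₃, …)` of natural numbers
with `∑ αᵢ = n`, `∑ (j - 1) πⱼ = n - 1` and `∑ i αᵢ = n + ∑ πⱼ - 1`. A tuple is a finitely
supported sequence: trailing zeros are irrelevant. -/
def indexSet (n : ℕ) : Set ((ℕ →₀ ℕ) × (ℕ →₀ ℕ)) :=
  {q | (∀ i ∈ q.1.support, 1 ≤ i) ∧ (∀ j ∈ q.2.support, 2 ≤ j) ∧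
    (q.1.sum fun _ a => a) = n ∧
    (q.2.sum fun j b => (j - 1) * b) + 1 = n ∧
    (q.1.sum fun i a => i * a) + 1 = n + q.2.sum fun _ b => b}

/-- The number of hypertrees on `n` vertices with `αᵢ` vertices of valency `i` and `πⱼ` edges of
size `j`, for all `i` and `j`. -/
noncomputable def hypertreeCount (n : ℕ) (α π : ℕ →₀ ℕ) : ℕ :=
  Nat.card {T : HypertreePoset n //
    (∀ i, (Finset.univ.filter fun v => T.valency v = i).card = α i) ∧
    ∀ j, (T.edges.filter fun e => e.card = j).card = π j}

/-- The rational number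
`(1 / n) * (n! / ∏_{j ≥ 2} (j-1)!^πⱼ πⱼ!) * (k! n! / ∏_{i ≥ 1} (i-1)!^αᵢ αᵢ!)`
with `k = ∑_{j ≥ 2} πⱼ - 1`. -/
noncomputable def coefficient (n : ℕ) (α π : ℕ →₀ ℕ) : ℚ :=
  1 / (n : ℚ) * ((n ! : ℚ) / ∏ j ∈ π.support, (((j - 1)! : ℚ) ^ π j * ((π j)! : ℚ))) *
    ((((π.sum fun _ b => b) - 1)! : ℚ) * (n ! : ℚ) /
      ∏ i ∈ α.support, (((i - 1)! : ℚ) ^ α i * ((α i)! : ℚ)))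

end HypertreePosets

/-!
The coefficient of a tensor in `Δ(h_n)` counts the hypertrees `T` on `n` vertices for which
`[0̂, T] ⊗ {z ∣ T ≤ z}` has the class of this tensor. So the theorem follows from the determination
of these two intervals and from the enumeration of hypertrees by valencies and sizes of edges.

**Hypertrees.** A hypergraph is a hypertree if and only if it is connected and acyclic
(`Hypertree.edgeConnected`, `Hypertree.edgeAcyclic`, `Hypertree.mk'`). Both properties are expressed
by predicates on vertices that are constant on edges, that is, by unions of connected components:
acyclicity says that, for a vertex `v` of an edge `e`, there is a union of components of the
hypergraph without `e` that meets `e` in `v` alone. With this form, hypertrees are built and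
compared by extending predicates, and walks are not needed any more.

**Intervals.** A hypertree above `T` amounts to a hypertree on each edge of `T`
(`Hypertree.nonempty_Ici_orderIso`), so that `{z ∣ T ≤ z}` is a product of posets `h_j`. A hypertree
below `T` amounts to a partition of the edges through each vertex
(`Hypertree.nonempty_Iic_orderIso`): it is obtained by merging the edges of each class of the
equivalence relation generated by these partitions, and acyclicity ensures that this relation
induces the given partition at each vertex. So `[0̂, T]` is a product of posets `p_i`.

**Enumeration.** Taking differences along edges is a linear map on the functions on vertices, whose
kernel consists of the constants if the hypergraph is connected, and which is surjective if and only
if the hypergraph is acyclic (`acyclic_iff_sum_card`). Hence a connected hypergraph is acyclic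
exactly when `∑ (|e| - 1) + 1` is the number of vertices. Therefore hypertrees with labelled
edges and given degrees correspond to connected bipartite graphs with given degrees and
one edge less than vertices; their number is a product of two multinomial coefficients, by induction
on the removal of a leaf (`card_bipTree`). Summing over all orders of the valencies and dividing by the number of labellings
gives the coefficient (`hypertreeCount_mul`). As the coefficients are positive, every element of the
index set comes from a hypertree, and this also shows that the index set is finite.
-/

namespace HypertreePosets

/-! ### Hypertrees as connected acyclic hypergraphs -/

/-- The predicate `p` on vertices takes the same truth value on all vertices of `e`. -/
def ConstOn {V : Type} (p : V → Prop) (e : Finset V) : Prop := ∀ u ∈ e, ∀ v ∈ e, (p u ↔ p v)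

theorem ConstOn.mono {V : Type} {p : V → Prop} {e f : Finset V} (h : ConstOn p e) (hf : f ⊆ e) :
    ConstOn p f := fun u hu v hv => h u (hf hu) v (hf hv)

/-- A hypergraph is connected when a predicate on vertices that is constant on every edge is
constant. -/
def EdgeConnected {V : Type} (E : Finset (Finset V)) : Prop :=
  ∀ p : V → Prop, (∀ e ∈ E, ConstOn p e) → ∀ u v, p u ↔ p v

/-- A hypergraph is acyclic when the removal of an edge `e` disconnects its vertices from each
other: for each `v ∈ e` there is a union `p` of connected components of the hypergraph without `e`
that meets `e` in `v` alone. -/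
def EdgeAcyclic {V : Type} (E : Finset (Finset V)) : Prop :=
  ∀ e ∈ E, ∀ v ∈ e, ∃ p : V → Prop, (∀ f ∈ E, f ≠ e → ConstOn p f) ∧ ∀ u ∈ e, (p u ↔ u = v)

section Walks

variable {V : Type} {E : Finset (Finset V)}

theorem IsWalk.append {s t f : V} {w w' : List (Finset V × V)} (h : IsWalk E s w t)
    (h' : IsWalk E t w' f) : IsWalk E s (w ++ w') f := by
  induction w generalizing s with
  | nil => obtain rfl : s = t := h; exact h'
  | cons a w ih => exact ⟨h.1, h.2.1, h.2.2.1, h.2.2.2.1, ih h.2.2.2.2⟩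

theorem IsWalk.of_append {s f : V} {w w' : List (Finset V × V)} (h : IsWalk E s (w ++ w') f) :
    ∃ t, IsWalk E s w t ∧ IsWalk E t w' f := by
  induction w generalizing s with
  | nil => exact ⟨s, rfl, h⟩
  | cons a w ih =>
    obtain ⟨t, h₁, h₂⟩ := ih h.2.2.2.2
    exact ⟨t, ⟨h.1, h.2.1, h.2.2.1, h.2.2.2.1, h₁⟩, h₂⟩

theorem IsWalk.mem_edges {s f : V} {w : List (Finset V × V)} (h : IsWalk E s w f) :
    ∀ e ∈ w.map Prod.fst, e ∈ E := by
  induction w generalizing s with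
  | nil => simp
  | cons a w ih =>
    simp only [List.map_cons, List.mem_cons]
    rintro e (rfl | he)
    · exact h.1
    · exact ih h.2.2.2.2 e he

theorem IsWalk.mono {E' : Finset (Finset V)} (hE : E ⊆ E') {s f : V} {w : List (Finset V × V)}
    (h : IsWalk E s w f) : IsWalk E' s w f := by
  induction w generalizing s with
  | nil => exact h
  | cons a w ih => exact ⟨hE h.1, h.2.1, h.2.2.1, h.2.2.2.1, ih h.2.2.2.2⟩

theorem IsWalk.iff_of_constOn {p : V → Prop} {s f : V} {w : List (Finset V × V)}
    (h : IsWalk E s w f) (hp : ∀ e ∈ w.map Prod.fst, ConstOn p e) : p s ↔ p f := by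
  induction w generalizing s with
  | nil => obtain rfl : s = f := h; rfl
  | cons a w ih =>
    simp only [List.map_cons, List.mem_cons, forall_eq_or_imp] at hp
    exact (hp.1 s h.2.1 a.2 h.2.2.1).trans (ih h.2.2.2.2 hp.2)

/-- Reachability by walks without repeated edges is constant on edges: a walk that already uses the
edge is cut at its first use. -/
theorem constOn_exists_walk (s : V) {e : Finset V} (he : e ∈ E) :
    ConstOn (fun v => ∃ w, IsWalk E s w v ∧ (w.map Prod.fst).Nodup) e := by
  suffices h : ∀ u ∈ e, ∀ v ∈ e, (∃ w, IsWalk E s w u ∧ (w.map Prod.fst).Nodup) →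
      ∃ w, IsWalk E s w v ∧ (w.map Prod.fst).Nodup from
    fun u hu v hv => ⟨h u hu v hv, h v hv u hu⟩
  rintro u hu v hv ⟨w, hw, hn⟩
  -- a walk avoiding `e` and ending in `e` can be extended by `e`
  have key : ∀ (w : List (Finset V × V)) (t : V), t ∈ e → IsWalk E s w t →
      (w.map Prod.fst).Nodup → e ∉ w.map Prod.fst →
      ∃ w, IsWalk E s w v ∧ (w.map Prod.fst).Nodup := by
    intro w t ht hw hn hew
    by_cases htv : t = v
    · exact ⟨w, htv ▸ hw, hn⟩
    · refine ⟨w ++ [(e, v)], hw.append ⟨he, ht, hv, htv, rfl⟩, ?_⟩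
      rw [List.map_append, List.nodup_append]
      refine ⟨hn, by simp, ?_⟩
      rintro a ha b hb rfl
      simp only [List.map_cons, List.map_nil, List.mem_singleton] at hb
      exact hew (hb ▸ ha)
  by_cases hew : e ∈ w.map Prod.fst
  · obtain ⟨⟨d, x⟩, hdx, rfl⟩ := List.mem_map.mp hew
    obtain ⟨w₁, w₂, rfl⟩ := List.append_of_mem hdx
    obtain ⟨t, h₁, h₂⟩ := hw.of_append
    rw [List.map_append, List.nodup_append] at hn
    exact key w₁ t h₂.2.1 h₁ hn.1 fun h => hn.2.2 _ h _ (by simp) rfl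
  · exact key w u hu hw hn hew

theorem Hypertree.edgeConnected (T : Hypertree V) : EdgeConnected T.edges := by
  intro p hp u v
  obtain ⟨w, hw, -⟩ := (T.existsUnique_walk u v).exists
  exact hw.iff_of_constOn fun e he => hp e (hw.mem_edges e he)

theorem Hypertree.edgeAcyclic (T : Hypertree V) : EdgeAcyclic T.edges := by
  classical
  intro e he v hv
  refine ⟨fun u => ∃ w, IsWalk (T.edges.erase e) v w u ∧ (w.map Prod.fst).Nodup,
    fun f hf hfe => constOn_exists_walk v (Finset.mem_erase.mpr ⟨hfe, hf⟩), fun u hu => ⟨?_, ?_⟩⟩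
  · rintro ⟨w, hw, hn⟩
    by_contra huv
    have hw' := (T.existsUnique_walk v u).unique (y₁ := w) (y₂ := [(e, u)])
      ⟨hw.mono (Finset.erase_subset _ _), hn⟩ ⟨⟨he, hv, hu, Ne.symm huv, rfl⟩, by simp⟩
    have := hw.mem_edges e (by simp [hw'])
    simp at this
  · rintro rfl
    exact ⟨[], rfl, by simp⟩

/-- In an acyclic hypergraph, the two ends of a walk that leaves an edge `e` for good at a vertex of
`e` and comes back to `e` coincide. -/
theorem EdgeAcyclic.eq_of_walk (hE : EdgeAcyclic E) {e : Finset V} (he : e ∈ E) {u v : V}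
    (hu : u ∈ e) (hv : v ∈ e) {w : List (Finset V × V)} (hw : IsWalk E u w v)
    (hew : e ∉ w.map Prod.fst) : u = v := by
  obtain ⟨p, hp, hpe⟩ := hE e he v hv
  refine (hpe u hu).mp ((hw.iff_of_constOn fun f hf => ?_).mpr ((hpe v hv).mpr rfl))
  exact hp f (hw.mem_edges f hf) fun h => hew (h ▸ hf)

/-- Walks without repeated edges are unique: if the first edge `e` of one of them did not start the
other one, a predicate separating the start from the rest of `e` would be constant along the
latter. -/
theorem EdgeAcyclic.walk_unique (hE : EdgeAcyclic E) {s f : V} {w w' : List (Finset V × V)}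
    (hw : IsWalk E s w f) (hn : (w.map Prod.fst).Nodup) (hw' : IsWalk E s w' f)
    (hn' : (w'.map Prod.fst).Nodup) : w = w' := by
  -- a walk without repeated edges from a vertex to itself is empty
  have closed : ∀ (s : V) (w : List (Finset V × V)), IsWalk E s w s → (w.map Prod.fst).Nodup →
      w = [] := by
    rintro s (_ | ⟨⟨e, v⟩, w⟩) h hn
    · rfl
    · rw [List.map_cons, List.nodup_cons] at hn
      exact absurd (hE.eq_of_walk h.1 h.2.2.1 h.2.1 h.2.2.2.2 hn.1).symm h.2.2.2.1
  induction w generalizing s w' with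
  | nil =>
    obtain rfl : s = f := hw
    exact (closed s w' hw' hn').symm
  | cons a w ih =>
    obtain ⟨e, v⟩ := a
    rcases w' with _ | ⟨⟨e', v'⟩, w'⟩
    · obtain rfl : s = f := hw'
      exact closed s _ hw hn
    obtain ⟨he, hse, hve, hsv, hw⟩ := hw
    rw [List.map_cons, List.nodup_cons] at hn
    obtain ⟨p, hp, hpe⟩ := hE e he s hse
    -- `p` separates `s` from the end of the walk
    have hpf : ¬ p f := by
      rw [← hw.iff_of_constOn fun d hd => hp d (hw.mem_edges d hd) fun h => hn.1 (h ▸ hd),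
        hpe v hve]
      exact Ne.symm hsv
    by_cases hee : e ∈ ((e', v') :: w').map Prod.fst
    · obtain ⟨⟨d, x⟩, hdx, rfl⟩ := List.mem_map.mp hee
      obtain ⟨w₁, w₂, h12⟩ := List.append_of_mem hdx
      rw [h12] at hw' hn' ⊢
      obtain ⟨t, h₁, h₂⟩ := hw'.of_append
      rw [List.map_append, List.nodup_append, List.map_cons, List.nodup_cons] at hn'
      have hts : s = t := hE.eq_of_walk he hse h₂.2.1 h₁
        fun h => hn'.2.2 _ h _ (by simp) rfl
      subst hts
      obtain rfl := closed s w₁ h₁ hn'.1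
      -- both walks start with `e`; their second vertices agree
      have hxv : x = v := by
        obtain ⟨p', hp', hpe'⟩ := hE d he x h₂.2.2.1
        have h3 := h₂.2.2.2.2.iff_of_constOn (p := p') fun c hc =>
          hp' c (h₂.2.2.2.2.mem_edges c hc) fun h => hn'.2.1.1 (h ▸ hc)
        have h4 := hw.iff_of_constOn (p := p') fun c hc =>
          hp' c (hw.mem_edges c hc) fun h => hn.1 (h ▸ hc)
        exact ((hpe' v hve).mp (h4.mpr (h3.mp ((hpe' x h₂.2.2.1).mpr rfl)))).symm
      subst hxv
      rw [ih hw hn.2 h₂.2.2.2.2 hn'.2.1.2]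
      rfl
    · refine absurd ((hw'.iff_of_constOn fun d hd => ?_).mp ((hpe s hse).mpr rfl)) hpf
      exact hp d (hw'.mem_edges d hd) fun h => hee (h ▸ hd)

/-- A connected acyclic hypergraph is a hypertree. -/
def Hypertree.mk' (E : Finset (Finset V)) (h2 : ∀ e ∈ E, 2 ≤ e.card) (hc : EdgeConnected E)
    (ha : EdgeAcyclic E) : Hypertree V where
  edges := E
  two_le_card := h2
  existsUnique_walk s f := by
    obtain ⟨w, hw, hn⟩ : ∃ w, IsWalk E s w f ∧ (w.map Prod.fst).Nodup :=
      (hc _ (fun e he => constOn_exists_walk s he) s f).mp ⟨[], rfl, by simp⟩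
    exact ⟨w, ⟨hw, hn⟩, fun w' hw' => ha.walk_unique hw'.1 hw'.2 hw hn⟩

end Walks

namespace Hypertree

variable {V : Type}

theorem exists_ne_mem (T : Hypertree V) {e : Finset V} (he : e ∈ T.edges) (v : V) :
    ∃ u ∈ e, u ≠ v :=
  Finset.exists_mem_ne (T.two_le_card e he) v

/-- Each predicate on the vertices of an edge extends to all vertices in such a way that it is
constant on all other edges. -/
theorem exists_extension (T : Hypertree V) {e : Finset V} (he : e ∈ T.edges) (q : V → Prop) :
    ∃ q' : V → Prop, (∀ v ∈ e, (q' v ↔ q v)) ∧ ∀ f ∈ T.edges, f ≠ e → ConstOn q' f := by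
  choose! p hp hpe using T.edgeAcyclic e he
  refine ⟨fun w => ∃ v ∈ e, q v ∧ p v w,
    fun v hv => ⟨?_, fun h => ⟨v, hv, h, (hpe v hv v hv).mpr rfl⟩⟩,
    fun f hf hfe u hu w hw => ?_⟩
  · rintro ⟨u, hu, hq, h⟩
    rwa [(hpe u hu v hv).mp h]
  · refine exists_congr fun v => and_congr_right fun hv => and_congr_right fun _ => ?_
    exact hp v hv f hf hfe u hu w hw

/-- The dual of `exists_extension`: each predicate on the edges through a vertex `v` extends to all
edges in such a way that it is constant on the edges through any other vertex. -/
theorem exists_dual_extension (T : Hypertree V) (v : V) (q : Finset V → Prop) :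
    ∃ q' : Finset V → Prop, (∀ e ∈ T.edges, v ∈ e → (q' e ↔ q e)) ∧
      ∀ w ≠ v, ∀ e ∈ T.edges, ∀ f ∈ T.edges, w ∈ e → w ∈ f → (q' e ↔ q' f) := by
  choose! p hp hpe using T.edgeAcyclic
  -- `e` is beyond the edge `d` through `v` when `d` separates it from `v`
  refine ⟨fun e => ∃ d ∈ T.edges, v ∈ d ∧ q d ∧ ∃ w ∈ e, ¬ p d v w,
    fun e he hv => ⟨?_, fun h => ?_⟩, ?_⟩
  · rintro ⟨d, hd, hvd, hq, w, hw, hpw⟩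
    by_cases hed : e = d
    · rwa [hed]
    · exact absurd ((hp d hd v hvd e he hed w hw v hv).mpr ((hpe d hd v hvd v hvd).mpr rfl)) hpw
  · obtain ⟨w, hw, hwv⟩ := T.exists_ne_mem he v
    exact ⟨e, he, hv, h, w, hw, fun h => hwv ((hpe e he v hv w hw).mp h)⟩
  · intro w hwv
    suffices h : ∀ e ∈ T.edges, ∀ f ∈ T.edges, w ∈ e → w ∈ f →
        (∃ d ∈ T.edges, v ∈ d ∧ q d ∧ ∃ w ∈ e, ¬ p d v w) →
        ∃ d ∈ T.edges, v ∈ d ∧ q d ∧ ∃ w ∈ f, ¬ p d v w from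
      fun e he f hf hwe hwf => ⟨h e he f hf hwe hwf, h f hf e he hwf hwe⟩
    rintro e he f hf hwe hwf ⟨d, hd, hvd, hq, u, hu, hpu⟩
    refine ⟨d, hd, hvd, hq, w, hwf, fun hpw => ?_⟩
    by_cases hed : e = d
    · subst hed
      exact hwv ((hpe e he v hvd w hwe).mp hpw)
    · exact hpu ((hp d hd v hvd e he hed w hwe u hu).mp hpw)

/-- Two edges of a hypertree share at most one vertex. -/
theorem eq_of_mem_of_mem (T : Hypertree V) {e f : Finset V} (he : e ∈ T.edges) (hf : f ∈ T.edges)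
    {u v : V} (huv : u ≠ v) (hue : u ∈ e) (hve : v ∈ e) (huf : u ∈ f) (hvf : v ∈ f) : e = f := by
  by_contra hef
  obtain ⟨p, hp, hpe⟩ := T.edgeAcyclic e he u hue
  exact huv ((hpe v hve).mp ((hp f hf (Ne.symm hef) u huf v hvf).mp ((hpe u hue).mpr rfl))).symm

theorem eq_of_subset_of_subset (T : Hypertree V) {e f g : Finset V} (he : e ∈ T.edges)
    (hf : f ∈ T.edges) (hg : 2 ≤ g.card) (hge : g ⊆ e) (hgf : g ⊆ f) : e = f := by
  obtain ⟨u, hu, v, hv, huv⟩ := Finset.one_lt_card.mp hg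
  exact T.eq_of_mem_of_mem he hf huv (hge hu) (hge hv) (hgf hu) (hgf hv)

theorem exists_edge_of_ne (T : Hypertree V) {u v : V} (huv : u ≠ v) : ∃ e ∈ T.edges, u ∈ e := by
  by_contra! h
  refine huv ((T.edgeConnected (· = u) (fun e he a ha b hb => ?_) u v).mp rfl).symm
  exact iff_of_false (fun h' => h e he (h' ▸ ha)) fun h' => h e he (h' ▸ hb)

/-- The order on hypertrees reduces to its second condition. -/
theorem le_iff [DecidableEq V] {T T' : Hypertree V} :
    T ≤ T' ↔ ∀ f ∈ T'.edges, ∃ e ∈ T.edges, f ⊆ e := by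
  refine ⟨fun h => h.2, fun h =>
    ⟨fun e he => ⟨T'.edges.filter (· ⊆ e), Finset.filter_subset _ _, ?_⟩, h⟩⟩
  ext v
  simp only [Finset.mem_biUnion, Finset.mem_filter, id]
  refine ⟨fun hv => ?_, fun ⟨f, hf, hvf⟩ => hf.2 hvf⟩
  by_contra! hcon
  obtain ⟨p, hp, hpe⟩ := T.edgeAcyclic e he v hv
  obtain ⟨u, hu, huv⟩ := T.exists_ne_mem he v
  -- if no edge of `T'` inside `e` contains `v`, then `p` is constant on the edges of `T'`
  refine huv ((hpe u hu).mp ((T'.edgeConnected p (fun f hf => ?_) u v).mpr ((hpe v hv).mpr rfl)))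
  obtain ⟨d, hd, hfd⟩ := h f hf
  by_cases hde : d = e
  · subst hde
    have hvf : v ∉ f := hcon f ⟨hf, hfd⟩
    intro a ha b hb
    rw [hpe a (hfd ha), hpe b (hfd hb)]
    exact iff_of_false (fun h' => hvf (h' ▸ ha)) fun h' => hvf (h' ▸ hb)
  · exact (hp d hd hde).mono hfd

/-- The edges of a finer hypertree contained in an edge `e` connect the vertices of `e`. -/
theorem constOn_of_le [DecidableEq V] {T T' : Hypertree V} (h : T ≤ T') {e : Finset V}
    (he : e ∈ T.edges) {q : V → Prop} (hq : ∀ f ∈ T'.edges, f ⊆ e → ConstOn q f) :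
    ConstOn q e := by
  obtain ⟨q', hq', hq''⟩ := T.exists_extension he q
  intro u hu v hv
  rw [← hq' u hu, ← hq' v hv]
  refine T'.edgeConnected q' (fun f hf => ?_) u v
  obtain ⟨d, hd, hfd⟩ := le_iff.mp h f hf
  by_cases hde : d = e
  · subst hde
    intro a ha b hb
    rw [hq' a (hfd ha), hq' b (hfd hb)]
    exact hq f hf hfd a ha b hb
  · exact (hq'' d hd hde).mono hfd

end Hypertree

end HypertreePosets

namespace HypertreePosets

/-! ### Hypertrees above a hypertree -/

namespace Hypertree

variable {V W : Type}

theorem _root_.Finset.exists_map_eq_of_subset_map_univ [Fintype W] (ι : W ↪ V) {f : Finset V}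
    (hf : f ⊆ Finset.univ.map ι) : ∃ g : Finset W, g.map ι = f := by
  classical
  refine ⟨Finset.univ.filter (ι · ∈ f), ?_⟩
  ext v
  simp only [Finset.mem_map, Finset.mem_filter, Finset.mem_univ, true_and]
  refine ⟨fun ⟨w, hw, h⟩ => h ▸ hw, fun hv => ?_⟩
  obtain ⟨w, -, rfl⟩ := Finset.mem_map.mp (hf hv)
  exact ⟨w, hv, rfl⟩

/-- The part of a hypertree `T' ≥ T` inside an edge of `T`, which is given as the image of an
embedding `ι` and identified with the source of `ι`. -/
def restrict [DecidableEq V] [Fintype W] {T T' : Hypertree V} (h : T ≤ T') (ι : W ↪ V)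
    (hι : Finset.univ.map ι ∈ T.edges) : Hypertree W :=
  mk' (Finset.univ.filter fun g => g.map ι ∈ T'.edges)
    (fun g hg => by
      rw [← Finset.card_map ι]
      exact T'.two_le_card _ (Finset.mem_filter.mp hg).2)
    (fun q hq u v => by
      have hc : ConstOn (fun x => ∃ w, ι w = x ∧ q w) (Finset.univ.map ι) := by
        refine constOn_of_le h hι fun f hf hfe => ?_
        obtain ⟨g, rfl⟩ := Finset.exists_map_eq_of_subset_map_univ ι hfe
        intro a ha b hb
        obtain ⟨a, ha', rfl⟩ := Finset.mem_map.mp ha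
        obtain ⟨b, hb', rfl⟩ := Finset.mem_map.mp hb
        simpa using hq g (by simpa using hf) a ha' b hb'
      simpa using hc (ι u) (by simp) (ι v) (by simp))
    (fun g hg w hw => by
      obtain ⟨p, hp, hpe⟩ := T'.edgeAcyclic _ (Finset.mem_filter.mp hg).2 (ι w)
        (Finset.mem_map_of_mem ι hw)
      refine ⟨fun x => p (ι x), fun f hf hfg a ha b hb => ?_, fun u hu => ?_⟩
      · exact hp _ (Finset.mem_filter.mp hf).2 (fun h' => hfg (Finset.map_injective ι h')) _
          (Finset.mem_map_of_mem ι ha) _ (Finset.mem_map_of_mem ι hb)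
      · exact (hpe _ (Finset.mem_map_of_mem ι hu)).trans ι.injective.eq_iff)

theorem mem_restrict [DecidableEq V] [Fintype W] {T T' : Hypertree V} {h : T ≤ T'} {ι : W ↪ V}
    {hι : Finset.univ.map ι ∈ T.edges} {g : Finset W} :
    g ∈ (restrict h ι hι).edges ↔ g.map ι ∈ T'.edges := by
  simp [restrict, mk']

section Glue

variable {T : Hypertree V} {W : T.edges → Type} {ι : ∀ e, W e ↪ V}

open Classical in
/-- The edges of the hypergraph obtained by replacing each edge of `T` by a hypertree on its
vertices. -/
noncomputable def glueEdges [Fintype V] (ι : ∀ e, W e ↪ V) (t : ∀ e, Hypertree (W e)) :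
    Finset (Finset V) :=
  Finset.univ.filter fun f => ∃ e, ∃ g ∈ (t e).edges, g.map (ι e) = f

theorem mem_glueEdges [Fintype V] {t : ∀ e, Hypertree (W e)} {f : Finset V} :
    f ∈ glueEdges ι t ↔ ∃ e, ∃ g ∈ (t e).edges, g.map (ι e) = f := by
  simp [glueEdges]

variable [∀ e, Fintype (W e)]

theorem map_subset_edge (hι : ∀ e, Finset.univ.map (ι e) = e.1) {e : T.edges}
    (g : Finset (W e)) : g.map (ι e) ⊆ e.1 := by
  rw [← hι e]
  exact Finset.map_subset_map.mpr (Finset.subset_univ g)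

theorem exists_map_eq_of_mem (hι : ∀ e, Finset.univ.map (ι e) = e.1) {e : T.edges}
    {v : V} (hv : v ∈ e.1) : ∃ w, ι e w = v := by
  rw [← hι e] at hv
  simpa using hv

/-- Replacing each edge of `T` by a hypertree on its vertices gives a hypertree. -/
theorem exists_glue [Fintype V] (hι : ∀ e, Finset.univ.map (ι e) = e.1) 
    (t : ∀ e, Hypertree (W e)) : ∃ T' : Hypertree V, T'.edges = glueEdges ι t := by
  refine ⟨mk' (glueEdges ι t) (fun f hf => ?_) (fun p hp => ?_) (fun f hf v hv => ?_), rfl⟩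
  · obtain ⟨e, g, hg, rfl⟩ := mem_glueEdges.mp hf
    rw [Finset.card_map]
    exact (t e).two_le_card g hg
  · refine T.edgeConnected p fun e he u hu v hv => ?_
    obtain ⟨a, rfl⟩ := exists_map_eq_of_mem hι (e := ⟨e, he⟩) hu
    obtain ⟨b, rfl⟩ := exists_map_eq_of_mem hι (e := ⟨e, he⟩) hv
    refine (t ⟨e, he⟩).edgeConnected (fun x => p (ι ⟨e, he⟩ x)) (fun g hg x hx y hy => ?_) a b
    exact hp _ (mem_glueEdges.mpr ⟨_, g, hg, rfl⟩) _ (Finset.mem_map_of_mem _ hx) _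
      (Finset.mem_map_of_mem _ hy)
  · obtain ⟨e, g, hg, rfl⟩ := mem_glueEdges.mp hf
    obtain ⟨w, hw, rfl⟩ := Finset.mem_map.mp hv
    obtain ⟨p, hp, hpe⟩ := (t e).edgeAcyclic g hg w hw
    -- separate inside the edge `e` of `T`, then extend to all vertices
    obtain ⟨p', hp', hpc⟩ := T.exists_extension e.2 fun v => ∃ x, ι e x = v ∧ p x
    have hp'' : ∀ x, p' (ι e x) ↔ p x := fun x => by
      rw [hp' _ (map_subset_edge hι Finset.univ (by simp))]
      simp
    refine ⟨p', fun f hf hfe => ?_, fun u hu => ?_⟩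
    · obtain ⟨d, g', hg', rfl⟩ := mem_glueEdges.mp hf
      by_cases hde : d = e
      · subst hde
        intro a ha b hb
        obtain ⟨a, ha', rfl⟩ := Finset.mem_map.mp ha
        obtain ⟨b, hb', rfl⟩ := Finset.mem_map.mp hb
        rw [hp'', hp'']
        exact hp g' hg' (fun h => hfe (h ▸ rfl)) a ha' b hb'
      · exact (hpc d d.2 fun h => hde (Subtype.ext h)).mono (map_subset_edge hι g')
    · obtain ⟨u, hu', rfl⟩ := Finset.mem_map.mp hu
      rw [hp'', hpe u hu', (ι e).injective.eq_iff]

/-- The hypertrees above `T` are obtained by choosing a hypertree on each edge of `T`. -/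
theorem nonempty_Ici_orderIso [Fintype V] [DecidableEq V] [∀ e, DecidableEq (W e)]
    (hι : ∀ e, Finset.univ.map (ι e) = e.1) :
    Nonempty (Set.Ici T ≃o ∀ e, Hypertree (W e)) := by
  have hmem : ∀ e : T.edges, Finset.univ.map (ι e) ∈ T.edges := fun e => (hι e).symm ▸ e.2
  let F : Set.Ici T ↪o ∀ e, Hypertree (W e) := OrderEmbedding.ofMapLEIff
    (fun T' e => restrict T'.2 (ι e) (hmem e)) (by
      rintro ⟨A, hA⟩ ⟨B, hB⟩
      rw [Set.mem_Ici] at hA hB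
      simp only [Pi.le_def, le_iff, mem_restrict, Subtype.mk_le_mk]
      refine ⟨fun h f hf => ?_, fun h e g hg => ?_⟩
      · obtain ⟨e, he, hfe⟩ := le_iff.mp hB f hf
        obtain ⟨g, rfl⟩ := Finset.exists_map_eq_of_subset_map_univ (ι ⟨e, he⟩)
          (hfe.trans_eq (hι ⟨e, he⟩).symm)
        obtain ⟨g', hg', hgg⟩ := h _ g hf
        exact ⟨_, hg', Finset.map_subset_map.mpr hgg⟩
      · obtain ⟨f, hf, hgf⟩ := h _ hg
        obtain ⟨e', he', hfe⟩ := le_iff.mp hA f hf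
        have hee : e.1 = e' := T.eq_of_subset_of_subset e.2 he' (B.two_le_card _ hg)
          (map_subset_edge hι g) (hgf.trans hfe)
        obtain ⟨g', rfl⟩ := Finset.exists_map_eq_of_subset_map_univ (ι e)
          (hfe.trans_eq (hee.symm.trans (hι e).symm))
        exact ⟨g', hf, Finset.map_subset_map.mp hgf⟩)
  refine ⟨RelIso.ofSurjective F fun t => ?_⟩
  obtain ⟨T', hT'⟩ := exists_glue hι t
  have hle : T ≤ T' := le_iff.mpr fun f hf => by
    rw [hT'] at hf
    obtain ⟨e, g, -, rfl⟩ := mem_glueEdges.mp hf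
    exact ⟨e, e.2, map_subset_edge hι g⟩
  refine ⟨⟨T', hle⟩, funext fun e => Hypertree.ext (Finset.ext fun g => ?_)⟩
  refine (mem_restrict (h := hle) (hι := hmem e)).trans ?_
  rw [hT', mem_glueEdges]
  refine ⟨fun ⟨d, g', hg', h⟩ => ?_, fun h => ⟨e, g, h, rfl⟩⟩
  obtain rfl : d = e := Subtype.ext <| T.eq_of_subset_of_subset d.2 e.2
    ((Finset.card_map _).symm ▸ (t d).two_le_card g' hg' : 2 ≤ (g'.map (ι d)).card)
    (map_subset_edge hι g') (h ▸ map_subset_edge hι g)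
  exact Finset.map_injective _ h ▸ hg'

end Glue

end Hypertree

end HypertreePosets

namespace HypertreePosets

/-! ### Hypertrees below a hypertree -/

namespace Hypertree

variable {V : Type} [DecidableEq V] {T : Hypertree V}

/-- A hypertree `S ≤ T` partitions the edges of `T` through a vertex `v` according to the edge of
`S` that contains them. -/
def mergeSetoid {S : Hypertree V} (h : S ≤ T) (v : V) : Setoid ↥(T.edges.filter (v ∈ ·)) where
  r e e' := ∃ f ∈ S.edges, e.1 ⊆ f ∧ e'.1 ⊆ f
  iseqv :=
    { refl := fun e => by
        obtain ⟨f, hf, hef⟩ := le_iff.mp h e (Finset.mem_filter.mp e.2).1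
        exact ⟨f, hf, hef, hef⟩
      symm := fun ⟨f, hf, h₁, h₂⟩ => ⟨f, hf, h₂, h₁⟩
      trans := fun {x y z} ⟨f, hf, h₁, h₂⟩ ⟨g, hg, h₃, h₄⟩ => by
        obtain rfl := S.eq_of_subset_of_subset hf hg
          (T.two_le_card y (Finset.mem_filter.mp y.2).1) h₂ h₃
        exact ⟨f, hf, h₁, h₄⟩ }

theorem mergeSetoid_iff {S : Hypertree V} {h : S ≤ T} {v : V}
    {e e' : ↥(T.edges.filter (v ∈ ·))} :
    mergeSetoid h v e e' ↔ ∃ f ∈ S.edges, e.1 ⊆ f ∧ e'.1 ⊆ f := Iff.rfl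

/-- A hypertree `S ≤ T` is determined, with the order, by the way it merges the edges of `T` at each
vertex. -/
theorem le_iff_mergeSetoid_le {S S' : Hypertree V} (h : S ≤ T) (h' : S' ≤ T) :
    S ≤ S' ↔ ∀ v, mergeSetoid h' v ≤ mergeSetoid h v := by
  refine ⟨fun hS v e e' => ?_, fun hm => le_iff.mpr fun f' hf' => ?_⟩
  · rintro ⟨f', hf', h₁, h₂⟩
    obtain ⟨f, hf, hff⟩ := le_iff.mp hS f' hf'
    exact ⟨f, hf, h₁.trans hff, h₂.trans hff⟩
  · -- the edges of `T` inside `f'` that lie in a suitable edge `f` of `S` cover a nonempty set of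
    -- vertices of `f'` that is closed under the edges of `T` inside `f'`
    have hcover : ∀ w ∈ f', ∃ e ∈ T.edges, w ∈ e ∧ e ⊆ f' := fun w hw => by
      obtain ⟨X, hX, rfl⟩ := h'.1 f' hf'
      obtain ⟨e, he, hwe⟩ := Finset.mem_biUnion.mp hw
      exact ⟨e, hX he, hwe, Finset.subset_biUnion_of_mem id he⟩
    obtain ⟨v, hv, -⟩ := S'.exists_ne_mem hf' (Finset.card_pos.mp
      (zero_lt_two.trans_le (S'.two_le_card f' hf'))).choose
    obtain ⟨e₀, he₀, hve₀, hef₀⟩ := hcover v hv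
    obtain ⟨f, hf, hef⟩ := le_iff.mp h e₀ he₀
    have hc : ConstOn (fun w => ∃ e ∈ T.edges, w ∈ e ∧ e ⊆ f' ∧ e ⊆ f) f' := by
      refine constOn_of_le h' hf' fun e he hef' => ?_
      suffices hs : ∀ u ∈ e, (∃ d ∈ T.edges, u ∈ d ∧ d ⊆ f' ∧ d ⊆ f) → e ⊆ f from
        fun u hu w hw => ⟨fun hd => ⟨e, he, hw, hef', hs u hu hd⟩,
          fun hd => ⟨e, he, hu, hef', hs w hw hd⟩⟩
      rintro u hu ⟨d, hd, hud, hdf', hdf⟩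
      obtain ⟨g, hg, hdg, heg⟩ := @hm u ⟨d, Finset.mem_filter.mpr ⟨hd, hud⟩⟩
        ⟨e, Finset.mem_filter.mpr ⟨he, hu⟩⟩ ⟨f', hf', hdf', hef'⟩
      rwa [S.eq_of_subset_of_subset hf hg (T.two_le_card d hd) hdf hdg]
    refine ⟨f, hf, fun w hw => ?_⟩
    obtain ⟨e, -, hwe, -, hef⟩ := (hc v hv w hw).mp ⟨e₀, he₀, hve₀, hef₀, hef⟩
    exact hef hwe

section Merge

variable (ρ : ∀ v, Setoid ↥(T.edges.filter (v ∈ ·)))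

/-- The equivalence relation on edges generated by equivalence relations on the edges through each
vertex. -/
def MergeRel : Finset V → Finset V → Prop :=
  Relation.EqvGen fun e e' => ∃ v, ∃ (he : e ∈ T.edges.filter (v ∈ ·))
    (he' : e' ∈ T.edges.filter (v ∈ ·)), ρ v ⟨e, he⟩ ⟨e', he'⟩

variable {ρ}

theorem MergeRel.symm {e e' : Finset V} (h : MergeRel ρ e e') : MergeRel ρ e' e :=
  Relation.EqvGen.symm _ _ h

theorem MergeRel.trans {e e' e'' : Finset V} (h : MergeRel ρ e e') (h' : MergeRel ρ e' e'') :
    MergeRel ρ e e'' := Relation.EqvGen.trans _ _ _ h h'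

/-- A property of edges that is invariant under the local relations is invariant under the
generated one. -/
theorem MergeRel.iff_of_invariant {Q : Finset V → Prop}
    (hQ : ∀ v, ∀ e (he : e ∈ T.edges.filter (v ∈ ·)), ∀ e' (he' : e' ∈ T.edges.filter (v ∈ ·)),
      ρ v ⟨e, he⟩ ⟨e', he'⟩ → Q e → Q e') {e e' : Finset V} (h : MergeRel ρ e e') :
    Q e ↔ Q e' := by
  induction h with
  | rel x y h =>
    obtain ⟨v, he, he', h⟩ := h
    exact ⟨hQ v _ he _ he' h, hQ v _ he' _ he ((ρ v).symm h)⟩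
  | refl x => rfl
  | symm x y _ ih => exact ih.symm
  | trans x y z _ _ ih₁ ih₂ => exact ih₁.trans ih₂

/-- On the edges through a vertex `v`, the generated equivalence relation is the given one: the
acyclicity of `T` leaves no other way to link these edges. -/
theorem MergeRel.rel {v : V} {e e' : ↥(T.edges.filter (v ∈ ·))} (h : MergeRel ρ e.1 e'.1) :
    ρ v e e' := by
  obtain ⟨q, hq, hqc⟩ := T.exists_dual_extension v fun d => ∃ hd, ρ v e ⟨d, hd⟩
  have he := Finset.mem_filter.mp e.2
  have he' := Finset.mem_filter.mp e'.2
  have hqq : q e.1 ↔ q e'.1 := by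
    refine h.iff_of_invariant fun w d hd d' hd' hdd hqd => ?_
    have hd₁ := Finset.mem_filter.mp hd
    have hd₁' := Finset.mem_filter.mp hd'
    by_cases hwv : w = v
    · subst hwv
      obtain ⟨_, hed⟩ := (hq d hd₁.1 hd₁.2).mp hqd
      exact (hq d' hd₁'.1 hd₁'.2).mpr ⟨hd', (ρ w).trans hed hdd⟩
    · exact (hqc w hwv d hd₁.1 d' hd₁'.1 hd₁.2 hd₁'.2).mp hqd
  obtain ⟨_, hee⟩ := (hq _ he'.1 he'.2).mp (hqq.mp ((hq _ he.1 he.2).mpr ⟨e.2, (ρ v).refl e⟩))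
  exact hee

variable (ρ) in
open Classical in
/-- The union of the edges that are equivalent to `e`. -/
noncomputable def mergedEdge (e : Finset V) : Finset V :=
  (T.edges.filter (MergeRel ρ e)).biUnion id

theorem mem_mergedEdge {e : Finset V} {v : V} :
    v ∈ mergedEdge ρ e ↔ ∃ d ∈ T.edges, MergeRel ρ e d ∧ v ∈ d := by
  simp [mergedEdge, and_assoc]

theorem subset_mergedEdge {e d : Finset V} (hd : d ∈ T.edges) (h : MergeRel ρ e d) :
    d ⊆ mergedEdge ρ e := fun _ hv => mem_mergedEdge.mpr ⟨d, hd, h, hv⟩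

theorem mergedEdge_eq {e e' : Finset V} (h : MergeRel ρ e e') :
    mergedEdge ρ e = mergedEdge ρ e' := by
  ext v
  simp only [mem_mergedEdge]
  exact exists_congr fun d => and_congr_right fun _ => and_congr_left fun _ =>
    ⟨h.symm.trans, h.trans⟩

theorem constOn_mergedEdge {p : V → Prop} {e : Finset V} (he : e ∈ T.edges)
    (hp : ∀ d ∈ T.edges, MergeRel ρ e d → ConstOn p d) : ConstOn p (mergedEdge ρ e) := by
  obtain ⟨w₀, hw₀, -⟩ := T.exists_ne_mem he (Finset.card_pos.mp
      (zero_lt_two.trans_le (T.two_le_card e he))).choose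
  suffices h : ∀ u ∈ mergedEdge ρ e, (p w₀ ↔ p u) from fun u hu v hv => (h u hu).symm.trans (h v hv)
  intro u hu
  obtain ⟨d, hd, hed, hud⟩ := mem_mergedEdge.mp hu
  have key := hed.iff_of_invariant (Q := fun d => MergeRel ρ e d ∧ ∀ w ∈ d, (p w₀ ↔ p w))
    fun v d hd d' hd' hdd h => by
      rw [Finset.mem_filter] at hd hd'
      have hed' : MergeRel ρ e d' := h.1.trans
        (Relation.EqvGen.rel _ _ ⟨v, Finset.mem_filter.mpr hd, Finset.mem_filter.mpr hd', hdd⟩)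
      exact ⟨hed', fun w hw => (h.2 v hd.2).trans (hp d' hd'.1 hed' v hd'.2 w hw)⟩
  exact (key.mp ⟨Relation.EqvGen.refl e, hp e he (Relation.EqvGen.refl e) w₀ hw₀⟩).2 u hud

/-- A vertex of a merged edge is separated from the other ones by edges of other classes: the
separating set consists of the vertices that every edge of the class through `v` leaves on the side
of `v`. -/
theorem exists_separation_mergedEdge {e : Finset V} {v : V}
    (hv : v ∈ mergedEdge ρ e) : ∃ p : V → Prop,
      (∀ d ∈ T.edges, ¬ MergeRel ρ e d → ConstOn p d) ∧ ∀ u ∈ mergedEdge ρ e, (p u ↔ u = v) := by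
  choose! p hp hpe using T.edgeAcyclic
  set q : V → Prop := fun w => ∀ d ∈ T.edges, MergeRel ρ e d → v ∈ d → p d v w with hq
  have hqv : q v := fun d hd _ hvd => (hpe d hd v hvd v hvd).mpr rfl
  have hqc : ∀ c ∈ T.edges, ¬ (MergeRel ρ e c ∧ v ∈ c) → ConstOn q c := by
    intro c hc hcv u hu w hw
    refine forall_congr' fun d => forall₃_congr fun hd hed hvd => ?_
    exact hp d hd v hvd c hc (fun h => hcv (h ▸ ⟨hed, hvd⟩)) u hu w hw
  refine ⟨q, fun d hd hed => hqc d hd fun h => hed h.1,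
    fun u hu => ⟨fun hqu => ?_, fun h => h ▸ hqv⟩⟩
  obtain ⟨d₁, hd₁, hed₁, hvd₁⟩ := mem_mergedEdge.mp hv
  obtain ⟨d₂, hd₂, hed₂, hud₂⟩ := mem_mergedEdge.mp hu
  -- an edge of the class through `v` meets `q` in `v` alone
  have hclean : ∀ d ∈ T.edges, MergeRel ρ e d → v ∈ d → ∀ w ∈ d, q w → w = v :=
    fun d hd hed hvd w hw h => (hpe d hd v hvd w hw).mp (h d hd hed hvd)
  have key := (hed₁.symm.trans hed₂).iff_of_invariant
    (Q := fun d => MergeRel ρ e d ∧ ∀ w ∈ d, q w → w = v) fun x d hd d' hd' hdd h => by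
      rw [Finset.mem_filter] at hd hd'
      have hed' : MergeRel ρ e d' := h.1.trans
        (Relation.EqvGen.rel _ _ ⟨x, Finset.mem_filter.mpr hd, Finset.mem_filter.mpr hd', hdd⟩)
      refine ⟨hed', ?_⟩
      by_cases hvd' : v ∈ d'
      · exact hclean d' hd'.1 hed' hvd'
      · intro w hw hqw
        have hqx : q x := (hqc d' hd'.1 (fun h => hvd' h.2) w hw x hd'.2).mp hqw
        exact absurd (h.2 x hd.2 hqx ▸ hd'.2) hvd'
  exact (key.mp ⟨hed₁, hclean d₁ hd₁ hed₁ hvd₁⟩).2 u hud₂ hqu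

theorem mergeRel_of_subset {e d : Finset V} (hd : d ∈ T.edges) (h : d ⊆ mergedEdge ρ e) :
    MergeRel ρ e d := by
  by_contra hed
  obtain ⟨v, hv, u, hu, hvu⟩ := Finset.one_lt_card.mp (T.two_le_card d hd)
  obtain ⟨p, hp, hpe⟩ := exists_separation_mergedEdge (h hv)
  exact hvu ((hpe u (h hu)).mp ((hp d hd hed v hv u hu).mp ((hpe v (h hv)).mpr rfl))).symm

variable (ρ) in
/-- Merging equivalent edges gives a hypertree. -/
theorem exists_merge : ∃ S : Hypertree V, S.edges = T.edges.image (mergedEdge ρ) := by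
  refine ⟨mk' (T.edges.image (mergedEdge ρ)) (fun f hf => ?_) (fun p hp => ?_)
    (fun f hf v hv => ?_), rfl⟩
  · obtain ⟨e, he, rfl⟩ := Finset.mem_image.mp hf
    exact (T.two_le_card e he).trans
      (Finset.card_le_card (subset_mergedEdge he (Relation.EqvGen.refl e)))
  · exact T.edgeConnected p fun e he => (hp _ (Finset.mem_image_of_mem _ he)).mono
      (subset_mergedEdge he (Relation.EqvGen.refl e))
  · obtain ⟨e, he, rfl⟩ := Finset.mem_image.mp hf
    obtain ⟨p, hp, hpe⟩ := exists_separation_mergedEdge hv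
    refine ⟨p, fun f hf hfe => ?_, hpe⟩
    obtain ⟨e', he', rfl⟩ := Finset.mem_image.mp hf
    exact constOn_mergedEdge he' fun d hd hed => hp d hd fun h =>
      hfe (mergedEdge_eq (hed.trans h.symm))

end Merge

/-- The hypertrees below `T` are obtained by choosing a partition of the edges of `T` through each
vertex. -/
theorem nonempty_Iic_orderIso (T : Hypertree V) :
    Nonempty (Set.Iic T ≃o ∀ v, (Setoid ↥(T.edges.filter (v ∈ ·)))ᵒᵈ) := by
  let F : Set.Iic T ↪o ∀ v, (Setoid ↥(T.edges.filter (v ∈ ·)))ᵒᵈ := OrderEmbedding.ofMapLEIff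
    (fun S v => OrderDual.toDual (mergeSetoid S.2 v)) fun S S' =>
      (le_iff_mergeSetoid_le S.2 S'.2).symm
  refine ⟨RelIso.ofSurjective F fun ρ => ?_⟩
  obtain ⟨S, hS⟩ := exists_merge fun v => OrderDual.ofDual (ρ v)
  have hle : S ≤ T := le_iff.mpr fun e he => ⟨_, hS ▸ Finset.mem_image_of_mem _ he,
    subset_mergedEdge he (Relation.EqvGen.refl e)⟩
  refine ⟨⟨S, hle⟩, funext fun v => ?_⟩
  change mergeSetoid hle v = OrderDual.ofDual (ρ v)
  ext e e'
  have he := (Finset.mem_filter.mp e.2).1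
  have he' := (Finset.mem_filter.mp e'.2).1
  rw [mergeSetoid_iff, hS]
  refine ⟨?_, fun h => ?_⟩
  · rintro ⟨f, hf, h₁, h₂⟩
    obtain ⟨d, hd, rfl⟩ := Finset.mem_image.mp hf
    exact MergeRel.rel (ρ := fun v => OrderDual.ofDual (ρ v))
      ((mergeRel_of_subset he h₁).symm.trans (mergeRel_of_subset he' h₂))
  · refine ⟨_, Finset.mem_image_of_mem _ he, subset_mergedEdge he (Relation.EqvGen.refl _),
      subset_mergedEdge he' (Relation.EqvGen.rel _ _ ⟨v, e.2, e'.2, h⟩)⟩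

end Hypertree

end HypertreePosets

namespace HypertreePosets

/-! ### The number of edges of a connected acyclic hypergraph -/

section Linear

variable {V M : Type} {e : M → Finset V}

/-- The differences of the values of a function on vertices along each edge `e j`, taken with
respect to a chosen vertex `r j` of this edge. -/
def edgeDifferences (e : M → Finset V) (r : M → V) :
    (V → ℚ) →ₗ[ℚ] ((Σ j, {v // v ∈ e j ∧ v ≠ r j}) → ℚ) where
  toFun g x := g x.2.1 - g (r x.1)
  map_add' g g' := by ext x; simp only [Pi.add_apply]; ring
  map_smul' c g := by ext x; simp only [Pi.smul_apply, smul_eq_mul, RingHom.id_apply]; ring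

theorem edgeDifferences_apply (r : M → V) (g : V → ℚ) (x : Σ j, {v // v ∈ e j ∧ v ≠ r j}) :
    edgeDifferences e r g x = g x.2.1 - g (r x.1) := rfl

variable [Fintype V] {r : M → V}

theorem card_sigma_edge [Fintype M] [DecidableEq V] (hr : ∀ j, r j ∈ e j) :
    Fintype.card (Σ j, {v // v ∈ e j ∧ v ≠ r j}) = ∑ j, ((e j).card - 1) := by
  rw [Fintype.card_sigma]
  refine Finset.sum_congr rfl fun j _ => ?_
  rw [← Finset.card_erase_of_mem (hr j), Fintype.card_subtype]
  congr 1
  ext v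
  simp [and_comm]

variable [Nonempty V]

/-- In a connected hypergraph, the functions without differences are the constant ones, so that the
rank of `edgeDifferences` is one less than the number of vertices. -/
theorem finrank_range_edgeDifferences
    (hc : ∀ p : V → Prop, (∀ j, ConstOn p (e j)) → ∀ u v, p u ↔ p v) :
    Module.finrank ℚ (LinearMap.range (edgeDifferences e r)) + 1 = Fintype.card V := by
  classical
  have hker : LinearMap.ker (edgeDifferences e r) = Submodule.span ℚ {fun _ : V => (1 : ℚ)} := by
    ext g
    rw [LinearMap.mem_ker, Submodule.mem_span_singleton]
    refine ⟨fun hg => ?_, ?_⟩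
    · obtain ⟨v₀⟩ := ‹Nonempty V›
      refine ⟨g v₀, funext fun v => ?_⟩
      have hconst : ∀ j, ∀ v ∈ e j, g v = g (r j) := fun j v hv => by
        by_cases hvr : v = r j
        · rw [hvr]
        · exact sub_eq_zero.mp (congrFun hg ⟨j, v, hv, hvr⟩)
      have := (hc (fun w => g w = g v₀) (fun j u hu w hw => by
        beta_reduce
        rw [hconst j u hu, hconst j w hw]) v v₀).mpr rfl
      simp [this]
    · rintro ⟨c, rfl⟩
      ext x
      simp [edgeDifferences_apply]
  have h := LinearMap.finrank_range_add_finrank_ker (edgeDifferences e r)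
  rwa [hker, finrank_span_singleton (fun h0 => by
    obtain ⟨v₀⟩ := ‹Nonempty V›
    simpa using congrFun h0 v₀), Module.finrank_fintype_fun_eq_card] at h

theorem surjective_edgeDifferences_iff [Fintype M]
    (hr : ∀ j, r j ∈ e j)
    (hc : ∀ p : V → Prop, (∀ j, ConstOn p (e j)) → ∀ u v, p u ↔ p v) :
    Function.Surjective (edgeDifferences e r) ↔
      ∑ j, ((e j).card - 1) + 1 = Fintype.card V := by
  classical
  rw [← LinearMap.range_eq_top, ← finrank_range_edgeDifferences (r := r) hc, ← card_sigma_edge hr,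
    ← Module.finrank_fintype_fun_eq_card (R := ℚ), add_left_inj]
  exact ⟨fun h => by rw [h, finrank_top], fun h => Submodule.eq_top_of_finrank_eq h.symm⟩

/-- A connected hypergraph is acyclic if and only if it has the number of vertices of a
hypertree. -/
theorem acyclic_iff_sum_card [Fintype M]
    (hr : ∀ j, r j ∈ e j)
    (hc : ∀ p : V → Prop, (∀ j, ConstOn p (e j)) → ∀ u v, p u ↔ p v) :
    (∀ j, ∀ v ∈ e j, ∃ p : V → Prop, (∀ k ≠ j, ConstOn p (e k)) ∧ ∀ u ∈ e j, (p u ↔ u = v)) ↔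
      ∑ j, ((e j).card - 1) + 1 = Fintype.card V := by
  classical
  rw [← surjective_edgeDifferences_iff hr hc]
  refine ⟨fun ha => ?_, fun hs j v hv => ?_⟩
  · choose! p hp hpe using ha
    intro t
    -- the separating set of `(j, v)` is mapped to the basis vector at `(j, v)`
    refine ⟨∑ x, t x • fun w => if p x.1 x.2.1 w then 1 else 0, ?_⟩
    rw [map_sum]
    conv_rhs => rw [pi_eq_sum_univ t]
    refine Finset.sum_congr rfl fun ⟨j, v, hv, hvr⟩ _ => ?_
    rw [map_smul]
    congr 1
    ext ⟨k, u, hu, hur⟩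
    rw [edgeDifferences_apply]
    by_cases hkj : k = j
    · subst hkj
      have h1 := hpe k v hv u hu
      have h2 := hpe k v hv (r k) (hr k)
      by_cases huv : u = v
      · subst huv
        simp [h1, h2, Ne.symm hvr]
      · simp [h1, h2, Ne.symm hvr, huv, Ne.symm huv]
    · have h1 := hp j v hv k hkj u hu (r k) (hr k)
      simp [h1, Ne.symm hkj]
  · obtain ⟨g, hg⟩ := hs fun x =>
      if x.1 = j then (if x.2.1 = v then 1 else 0) - (if r j = v then 1 else 0) else 0
    have hk : ∀ k ≠ j, ∀ u ∈ e k, g u = g (r k) := fun k hkj u hu => by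
      by_cases hur : u = r k
      · rw [hur]
      · have := congrFun hg ⟨k, u, hu, hur⟩
        rw [edgeDifferences_apply] at this
        simpa [hkj, sub_eq_zero] using this
    have hj : ∀ u ∈ e j, g u - g (r j) + (if r j = v then 1 else 0) = if u = v then 1 else 0 :=
      fun u hu => by
        by_cases hur : u = r j
        · simp [hur]
        · have := congrFun hg ⟨j, u, hu, hur⟩
          rw [edgeDifferences_apply] at this
          simp only [if_true] at this
          rw [this]
          ring
    refine ⟨fun w => g w - g (r j) + (if r j = v then 1 else 0) = 1, fun k hkj u hu w hw => ?_,
      fun u hu => ?_⟩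
    · beta_reduce
      rw [hk k hkj u hu, hk k hkj w hw]
    · beta_reduce
      rw [hj u hu]
      simp

end Linear

/-- The number of vertices of a hypertree with at least one vertex. -/
theorem Hypertree.sum_card_sub_one {V : Type} [Fintype V] [Nonempty V] (T : Hypertree V) :
    ∑ e ∈ T.edges, (e.card - 1) + 1 = Fintype.card V := by
  have hne : ∀ e : T.edges, ∃ v, v ∈ e.1 := fun e =>
    Finset.card_pos.mp (zero_lt_two.trans_le (T.two_le_card e e.2))
  choose r hr using hne
  rw [← Finset.sum_coe_sort, ← acyclic_iff_sum_card hr fun p hp =>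
    T.edgeConnected p fun e he => hp ⟨e, he⟩]
  intro e v hv
  obtain ⟨p, hp, hpe⟩ := T.edgeAcyclic e e.2 v hv
  exact ⟨p, fun f hf => hp f f.2 fun h => hf (Subtype.ext h), hpe⟩

end HypertreePosets

namespace HypertreePosets

/-! ### Bipartite trees with given degrees -/

section Bipartite

variable {V M : Type}

/-- A bipartite graph, given by its incidence matrix, is connected when a predicate on its vertices
that takes equal values at the ends of each edge is constant. -/
def BipConnected (R : V → M → Bool) : Prop :=
  ∀ p : V ⊕ M → Prop, (∀ v j, R v j = true → (p (.inl v) ↔ p (.inr j))) → ∀ x y, p x ↔ p y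

/-- The connected bipartite graphs in which `v : V` has degree `d v` and `j : M` has degree
`s j`. -/
def BipTree [Fintype V] [Fintype M] (d : V → ℕ) (s : M → ℕ) : Type :=
  {R : V → M → Bool // BipConnected R ∧ (∀ v, ∑ j, (R v j).toNat = d v) ∧
    ∀ j, ∑ v, (R v j).toNat = s j}

theorem BipConnected.swap {R : V → M → Bool} (h : BipConnected R) :
    BipConnected fun j v => R v j := by
  intro p hp x y
  have := h (fun z => p z.swap) (fun v j hvj => (hp j v hvj).symm) x.swap y.swap
  simpa using this

theorem BipConnected.comp_equiv {V' : Type} {R : V → M → Bool} (h : BipConnected R) (σ : V' ≃ V) :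
    BipConnected fun v => R (σ v) := by
  intro p hp x y
  have := h (fun z => p (z.map σ.symm id)) (fun v j hvj => by
    have := hp (σ.symm v) j
    simp only [Equiv.apply_symm_apply] at this
    exact this hvj) (x.map σ id) (y.map σ id)
  simpa [Sum.map_map] using this

theorem bipConnected_option_iff {R : Option V → M → Bool} {j : M}
    (hR : ∀ k, R none k = true ↔ k = j) :
    BipConnected R ↔ BipConnected fun v => R (some v) := by
  refine ⟨fun h p hp => ?_, fun h p hp => ?_⟩
  · -- the leaf gets the value of its neighbour
    have := h (Sum.elim (fun o => o.elim (p (.inr j)) fun v => p (.inl v)) fun k => p (.inr k)) (by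
      rintro (_ | v) k hk
      · obtain rfl := (hR k).mp hk
        rfl
      · exact hp v k hk)
    rintro (v | k) (w | l)
    · exact this (.inl (some v)) (.inl (some w))
    · exact this (.inl (some v)) (.inr l)
    · exact this (.inr k) (.inl (some w))
    · exact this (.inr k) (.inr l)
  · have := h (fun x => p (x.map some id)) (fun v k hk => hp (some v) k hk)
    have key : ∀ x, p x ↔ p (.inr j) := by
      rintro ((_ | v) | k)
      · exact hp none j ((hR j).mpr rfl)
      · exact this (.inl v) (.inr j)
      · exact this (.inr k) (.inr j)
    exact fun x y => (key x).trans (key y).symm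

variable [Fintype V] [Fintype M]

instance (d : V → ℕ) (s : M → ℕ) : Finite (BipTree d s) :=
  Subtype.finite

theorem card_bipTree_swap (d : V → ℕ) (s : M → ℕ) :
    Nat.card (BipTree d s) = Nat.card (BipTree s d) :=
  Nat.card_congr
    { toFun := fun R => ⟨fun j v => R.1 v j, R.2.1.swap, R.2.2.2, R.2.2.1⟩
      invFun := fun R => ⟨fun j v => R.1 v j, R.2.1.swap, R.2.2.2, R.2.2.1⟩
      left_inv := fun _ => rfl
      right_inv := fun _ => rfl }

theorem card_bipTree_comp_equiv {V' : Type} [Fintype V'] (σ : V' ≃ V) (d : V → ℕ) (s : M → ℕ) :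
    Nat.card (BipTree (d ∘ σ) s) = Nat.card (BipTree d s) := by
  refine Nat.card_congr
    { toFun := fun R => ⟨fun v => R.1 (σ.symm v), R.2.1.comp_equiv σ.symm, fun v => ?_, fun j => ?_⟩
      invFun := fun R => ⟨fun v => R.1 (σ v), R.2.1.comp_equiv σ, fun v => ?_, fun j => ?_⟩
      left_inv := fun R => ?_
      right_inv := fun R => ?_ }
  · simpa using R.2.2.1 (σ.symm v)
  · rw [← R.2.2.2 j]
    exact Equiv.sum_comp σ.symm fun v => (R.1 v j).toNat
  · exact R.2.2.1 (σ v)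
  · rw [← R.2.2.2 j]
    exact Equiv.sum_comp σ fun v => (R.1 v j).toNat
  · exact Subtype.ext (funext fun v => by simp)
  · exact Subtype.ext (funext fun v => by simp)

/-- There is no isolated vertex in a connected bipartite graph with vertices on both sides. -/
theorem card_bipTree_eq_zero [Nonempty V] {d : V → ℕ} {s : M → ℕ} {j : M} (hj : s j = 0) :
    Nat.card (BipTree d s) = 0 := by
  rw [Nat.card_eq_zero]
  left
  refine ⟨fun ⟨R, hR, _, hs⟩ => ?_⟩
  have h0 : ∀ v, R v j = false := fun v => by
    have := hs j
    rw [hj, Finset.sum_eq_zero_iff] at this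
    simpa using this v (Finset.mem_univ v)
  have := hR (fun x => x = .inr j) (fun v k hvk => by
    simp only [reduceCtorEq, Sum.inr.injEq, false_iff]
    rintro rfl
    rw [h0 v] at hvk
    exact Bool.false_ne_true hvk) (.inr j) (.inl (Classical.arbitrary V))
  simp at this

theorem exists_forall_iff_of_sum_toNat_eq_one {f : M → Bool} (h : ∑ j, (f j).toNat = 1) :
    ∃ j, ∀ k, f k = true ↔ k = j := by
  obtain ⟨j, -, hj⟩ : ∃ j ∈ Finset.univ, (f j).toNat ≠ 0 := Finset.exists_ne_zero_of_sum_ne_zero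
    (by rw [h]; exact one_ne_zero)
  have hj' : f j = true := by simpa using hj
  refine ⟨j, fun k => ⟨fun hk => ?_, fun hk => hk ▸ hj'⟩⟩
  classical
  by_contra hkj
  have h2 : ∑ i ∈ {j, k}, (f i).toNat ≤ ∑ j, (f j).toNat :=
    Finset.sum_le_sum_of_subset (Finset.subset_univ _)
  rw [Finset.sum_pair (Ne.symm hkj), hj', hk, h] at h2
  simp at h2

/-- Removing a leaf: the graphs with a leaf `none` are classified by the neighbour of this leaf. -/
theorem card_bipTree_option [DecidableEq M] (d : Option V → ℕ) (hd : d none = 1) (s : M → ℕ)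
    (hs : ∀ j, 1 ≤ s j) : Nat.card (BipTree d s) =
      ∑ j, Nat.card (BipTree (fun v => d (some v)) (Function.update s j (s j - 1))) := by
  have hrow : ∀ j k : M, (decide (k = j)) = true ↔ k = j := fun j k => decide_eq_true_iff
  rw [← Nat.card_sigma]
  refine (Nat.card_eq_of_bijective (fun x : Σ j, BipTree (fun v => d (some v))
    (Function.update s j (s j - 1)) => (⟨fun o => o.elim (fun k => decide (k = x.1)) x.2.1,
      (bipConnected_option_iff (hrow x.1)).mpr x.2.2.1, ?_, ?_⟩ : BipTree d s)) ⟨?_, ?_⟩).symm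
  · rintro (_ | v)
    · simp only [Option.elim_none, hd]
      rw [Finset.sum_eq_single x.1] <;> simp +contextual
    · exact x.2.2.2.1 v
  · intro k
    have := x.2.2.2.2 k
    have hk := hs k
    rw [Fintype.sum_option]
    simp only [Option.elim_none, Option.elim_some]
    rw [this]
    by_cases hkx : k = x.1
    · rw [hkx] at hk ⊢
      simp only [decide_true, Bool.toNat_true, Function.update_self]
      omega
    · simp [hkx]
  · rintro ⟨j, R⟩ ⟨j', R'⟩ h
    have h' := congrArg Subtype.val h
    have h1 := congrFun (congrFun h' none) j
    simp only [Option.elim_none, decide_true] at h1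
    obtain rfl : j = j' := by simpa using h1.symm
    congr 1
    exact Subtype.ext (funext fun v => congrFun h' (some v))
  · rintro ⟨R, hR, hRd, hRs⟩
    obtain ⟨j, hj⟩ := exists_forall_iff_of_sum_toNat_eq_one ((hRd none).trans hd)
    refine ⟨⟨j, ⟨fun v => R (some v), (bipConnected_option_iff hj).mp hR, fun v => hRd (some v),
      fun k => ?_⟩⟩, ?_⟩
    · have hk := hRs k
      rw [Fintype.sum_option] at hk
      by_cases hkj : k = j
      · subst hkj
        rw [(hj k).mpr rfl] at hk
        rw [Function.update_self, ← hk]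
        simp
      · rw [Function.update_of_ne hkj, ← hk, Bool.eq_false_iff.mpr fun h => hkj ((hj k).mp h)]
        simp
    · refine Subtype.ext (funext fun o => ?_)
      rcases o with _ | v
      · funext k
        rw [Bool.eq_iff_iff, hj k]
        simp
      · rfl

end Bipartite

theorem sum_sub_one_add_card {ι : Type} [Fintype ι] {f : ι → ℕ} (hf : ∀ i, 1 ≤ f i) :
    ∑ i, (f i - 1) + Fintype.card ι = ∑ i, f i := by
  rw [Fintype.card_eq_sum_ones, ← Finset.sum_add_distrib]
  exact Finset.sum_congr rfl fun i _ => Nat.sub_add_cancel (hf i)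

/-- The number of trees on two given sets of vertices with given degrees, each edge of which joins
the two sets. -/
theorem card_bipTree (k : ℕ) : ∀ (V M : Type) [Fintype V] [Fintype M] [Nonempty V] [Nonempty M]
    (d : V → ℕ) (s : M → ℕ), Fintype.card V + Fintype.card M = k →
    (∀ v, 1 ≤ d v) → (∀ j, 1 ≤ s j) → ∑ v, d v + 1 = k → ∑ j, s j + 1 = k →
    Nat.card (BipTree d s) * ((∏ v, (d v - 1)!) * ∏ j, (s j - 1)!) =
      (Fintype.card V - 1)! * (Fintype.card M - 1)! := by
  induction k with
  | zero => intros; omega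
  | succ k ih =>
    classical
    -- the inductive step when there is a leaf in `V`
    have step : ∀ (V M : Type) [Fintype V] [Fintype M] [Nonempty V] [Nonempty M]
        (d : V → ℕ) (s : M → ℕ), Fintype.card V + Fintype.card M = k + 1 →
        (∀ v, 1 ≤ d v) → (∀ j, 1 ≤ s j) → ∑ v, d v + 1 = k + 1 → ∑ j, s j + 1 = k + 1 →
        2 < k + 1 → (∃ v, d v = 1) →
        Nat.card (BipTree d s) * ((∏ v, (d v - 1)!) * ∏ j, (s j - 1)!) =
          (Fintype.card V - 1)! * (Fintype.card M - 1)! := by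
      intro V M _ _ _ _ d s hk hd hs hdk hsk h2 ⟨v₀, hv₀⟩
      let σ : Option {v // v ≠ v₀} ≃ V := Equiv.optionSubtypeNe v₀
      have hσ : σ none = v₀ := rfl
      have hcard : Fintype.card V = Fintype.card {v // v ≠ v₀} + 1 := by
        rw [← Fintype.card_congr σ, Fintype.card_option]
      have hsumd := Equiv.sum_comp σ d
      have hprodd := Equiv.prod_comp σ fun v => (d v - 1)!
      rw [Fintype.sum_option, hσ, hv₀] at hsumd
      rw [Fintype.prod_option, hσ, hv₀, Nat.sub_self, Nat.factorial_zero, one_mul] at hprodd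
      have hsums := sum_sub_one_add_card hs
      have hMpos : 1 ≤ Fintype.card M := Fintype.card_pos
      have hne : Nonempty {v // v ≠ v₀} := by
        by_contra hemp
        rw [not_nonempty_iff] at hemp
        simp only [Finset.univ_eq_empty, Finset.sum_empty, add_zero] at hsumd
        omega
      have hVpos : 1 ≤ Fintype.card {v // v ≠ v₀} := Fintype.card_pos
      rw [← card_bipTree_comp_equiv σ, card_bipTree_option _ (by simp [hσ, hv₀]) s hs, ← hprodd,
        Finset.sum_mul]
      have hterm : ∀ j, Nat.card (BipTree (fun v => (d ∘ σ) (some v))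
          (Function.update s j (s j - 1))) * ((∏ v, (d (σ (some v)) - 1)!) * ∏ j, (s j - 1)!) =
          (s j - 1) * ((Fintype.card {v // v ≠ v₀} - 1)! * (Fintype.card M - 1)!) := by
        intro j
        have hsj := hs j
        rcases Nat.eq_or_lt_of_le hsj with h1 | h1
        · rw [card_bipTree_eq_zero (j := j) (by simp [← h1]), ← h1]
          simp
        · have hupd : ∑ i, Function.update s j (s j - 1) i + 1 = ∑ i, s i := by
            rw [Finset.sum_update_of_mem (Finset.mem_univ j),
              ← Finset.add_sum_erase _ s (Finset.mem_univ j), Finset.sdiff_singleton_eq_erase]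
            omega
          have hprod : ∏ i, (s i - 1)! =
              (s j - 1) * ∏ i, (Function.update s j (s j - 1) i - 1)! := by
            rw [← Finset.mul_prod_erase _ _ (Finset.mem_univ j),
              ← Finset.mul_prod_erase (a := j)
                (f := fun i => (Function.update s j (s j - 1) i - 1)!) _ (Finset.mem_univ j),
              ← mul_assoc, Function.update_self,
              Nat.mul_factorial_pred (by omega)]
            congr 1
            refine Finset.prod_congr rfl fun i hi => ?_
            rw [Function.update_of_ne (Finset.ne_of_mem_erase hi)]
          rw [← ih {v // v ≠ v₀} M (fun v => (d ∘ σ) (some v)) (Function.update s j (s j - 1))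
            (by omega) (fun v => hd _) (fun i => ?_) (by simp only [Function.comp]; omega)
            (by omega), hprod]
          · simp only [Function.comp]
            ring
          · by_cases hij : i = j
            · subst hij
              rw [Function.update_self]
              omega
            · rw [Function.update_of_ne hij]
              exact hs i
      rw [Finset.sum_congr rfl fun j _ => hterm j, ← Finset.sum_mul, ← mul_assoc, hcard,
        Nat.add_sub_cancel, show ∑ j, (s j - 1) = Fintype.card {v // v ≠ v₀} by omega,
        Nat.mul_factorial_pred (by omega)]
    intro V M _ _ _ _ d s hk hd hs hdk hsk
    have hVpos : 1 ≤ Fintype.card V := Fintype.card_pos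
    have hMpos : 1 ≤ Fintype.card M := Fintype.card_pos
    have hsumd := sum_sub_one_add_card hd
    have hsums := sum_sub_one_add_card hs
    by_cases h2 : 2 < k + 1
    · by_cases hv : ∃ v, d v = 1
      · exact step V M d s hk hd hs hdk hsk h2 hv
      by_cases hj : ∃ j, s j = 1
      · rw [card_bipTree_swap, mul_comm (∏ v, (d v - 1)!), mul_comm (Fintype.card V - 1)!]
        exact step M V s d (by omega) hs hd hsk hdk h2 hj
      -- without leaves, the degrees add up to twice the number of vertices at least
      push Not at hv hj
      have h3 : Fintype.card V ≤ ∑ v, (d v - 1) := by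
        rw [Fintype.card_eq_sum_ones]
        exact Finset.sum_le_sum fun v _ => by have := hd v; have := hv v; omega
      have h4 : Fintype.card M ≤ ∑ j, (s j - 1) := by
        rw [Fintype.card_eq_sum_ones]
        exact Finset.sum_le_sum fun v _ => by have := hs v; have := hj v; omega
      omega
    · -- a single edge
      have hV1 : Fintype.card V = 1 := by omega
      have hM1 : Fintype.card M = 1 := by omega
      obtain ⟨v₀, hv₀⟩ := Fintype.card_eq_one_iff.mp hV1
      obtain ⟨j₀, hj₀⟩ := Fintype.card_eq_one_iff.mp hM1
      have hu : (Finset.univ : Finset V) = {v₀} := by ext v; simp [hv₀ v]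
      have hu' : (Finset.univ : Finset M) = {j₀} := by ext v; simp [hj₀ v]
      simp only [hu, hu', Finset.sum_singleton] at hdk hsk
      have hd1 : d v₀ = 1 := by omega
      have hs1 : s j₀ = 1 := by omega
      have hone : Nat.card (BipTree d s) = 1 := by
        rw [Nat.card_eq_one_iff_exists]
        refine ⟨⟨fun _ _ => true, fun p hp => ?_, fun v => ?_, fun j => ?_⟩,
          fun ⟨R, _, hRd, _⟩ => ?_⟩
        · rintro (v | j) (w | l)
          · rw [hv₀ v, hv₀ w]
          · exact hp v l rfl
          · exact (hp w j rfl).symm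
          · rw [hj₀ j, hj₀ l]
        · simp [hu', hv₀ v, hd1]
        · simp [hu, hj₀ j, hs1]
        · refine Subtype.ext (funext fun v => funext fun j => ?_)
          have := hRd v
          rw [hu', Finset.sum_singleton, hv₀ v, hd1] at this
          rw [hv₀ v, hj₀ j]
          simpa using this
      rw [hone, hV1, hM1, hu, hu', Finset.prod_singleton, Finset.prod_singleton, hd1, hs1]
      rfl

end HypertreePosets

namespace HypertreePosets

/-! ### Functions with given numbers of elements in their fibres -/

/-- `c i` is the number of elements that `f` maps to `i`, for all `i`. -/
def HasFibers {A : Type} [Fintype A] (f : A → ℕ) (c : ℕ →₀ ℕ) : Prop :=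
  ∀ i, (Finset.univ.filter fun a => f a = i).card = c i

namespace HasFibers

variable {A B : Type} [Fintype A] [Fintype B] {f : A → ℕ} {g : B → ℕ} {c : ℕ →₀ ℕ}

theorem image_eq_support (h : HasFibers f c) : Finset.univ.image f = c.support := by
  ext i
  rw [Finsupp.mem_support_iff, ← h i, Finset.card_ne_zero, Finset.mem_image]
  exact ⟨fun ⟨a, _, ha⟩ => ⟨a, by simpa using ha⟩, fun ⟨a, ha⟩ => ⟨a, by simpa using ha⟩⟩

theorem mem_support (h : HasFibers f c) (a : A) : f a ∈ c.support := by
  rw [← h.image_eq_support]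
  exact Finset.mem_image_of_mem f (Finset.mem_univ a)

theorem sum_comp (h : HasFibers f c) (F : ℕ → ℕ) : ∑ a, F (f a) = c.sum fun i k => k * F i := by
  rw [Finset.sum_comp F f, h.image_eq_support, Finsupp.sum]
  exact Finset.sum_congr rfl fun i _ => by rw [h i, smul_eq_mul]

theorem prod_comp {R : Type*} [CommMonoid R] (h : HasFibers f c) (F : ℕ → R) :
    ∏ a, F (f a) = ∏ i ∈ c.support, F i ^ c i := by
  rw [Finset.prod_comp F f, h.image_eq_support]
  exact Finset.prod_congr rfl fun i _ => by rw [h i]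

theorem card_eq (h : HasFibers f c) : Fintype.card A = c.sum fun _ k => k := by
  simpa using h.sum_comp fun _ => 1

theorem comp_equiv (h : HasFibers g c) (σ : A ≃ B) (hσ : ∀ a, g (σ a) = f a) :
    HasFibers f c := by
  intro i
  rw [← h i]
  refine Finset.card_equiv σ fun a => ?_
  simp [hσ]

theorem exists_of_sum_eq {N : ℕ} (h : (c.sum fun _ k => k) = N) :
    ∃ f : Fin N → ℕ, HasFibers f c := by
  have hl : c.toMultiset.toList.length = N := by
    rw [Multiset.length_toList, Finsupp.card_toMultiset, ← h]
    rfl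
  subst hl
  refine ⟨c.toMultiset.toList.get, fun i => ?_⟩
  have h1 : (Finset.univ.val.map c.toMultiset.toList.get).count i = c i := by
    rw [Fin.univ_val_map, List.ofFn_get, Multiset.coe_toList, Finsupp.count_toMultiset]
  rw [← h1, Multiset.count_map, Finset.card_def, Finset.filter_val]
  simp only [eq_comm]

/-- The number of bijections that are compatible with two functions with the same numbers of
elements in their fibres. -/
theorem card_equiv (hf : HasFibers f c) (hg : HasFibers g c) :
    Nat.card {σ : A ≃ B // ∀ a, g (σ a) = f a} = ∏ i ∈ c.support, (c i)! := by
  classical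
  have hfib : ∀ i, Nonempty ({a // f a = i} ≃ {b // g b = i}) := fun i => by
    rw [← Fintype.card_eq, Fintype.card_subtype, Fintype.card_subtype, hf i, hg i]
  let e := fun i => Classical.choice (hfib i)
  let τ : A ≃ B := Equiv.ofFiberEquiv e
  have hτ : ∀ a, g (τ a) = f a := Equiv.ofFiberEquiv_map e
  have hτ' : ∀ b, f (τ.symm b) = g b := fun b => by rw [← hτ, Equiv.apply_symm_apply]
  have h1 : Nat.card {σ : A ≃ B // ∀ a, g (σ a) = f a} =
      Nat.card {σ : Equiv.Perm A // f ∘ σ = f} := by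
    refine Nat.card_congr
      { toFun := fun σ => ⟨σ.1.trans τ.symm, funext fun a => ?_⟩
        invFun := fun σ => ⟨σ.1.trans τ, fun a => ?_⟩
        left_inv := fun σ => Subtype.ext (Equiv.ext fun a => by simp)
        right_inv := fun σ => Subtype.ext (Equiv.ext fun a => by simp) }
    · simp [hτ', σ.2 a]
    · rw [Equiv.trans_apply, hτ]
      exact congrFun σ.2 a
  rw [h1, Nat.card_eq_fintype_card, DomMulAct.stabilizer_card', hf.image_eq_support]
  refine Finset.prod_congr rfl fun i _ => ?_
  rw [Fintype.card_subtype, hf i]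

end HasFibers

/-! ### The number of hypertrees with given valencies and sizes of edges -/

theorem sum_toNat_decide {A : Type} (s : Finset A) (p : A → Prop) [DecidablePred p] :
    ∑ a ∈ s, (decide (p a)).toNat = (s.filter p).card := by
  rw [Finset.card_filter]
  exact Finset.sum_congr rfl fun a _ => by by_cases h : p a <;> simp [h]

section Labelled

variable {V M : Type} [Fintype V] [DecidableEq V] [Fintype M]

/-- The incidence graphs of the hypertrees with labelled edges of sizes `s j ≥ 2` are the connected
bipartite graphs with one edge less than vertices. -/
theorem card_bipTree_eq_card_labelled [Nonempty V] {d : V → ℕ} {s : M → ℕ} (hs : ∀ j, 2 ≤ s j)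
    (hsum : ∑ j, s j + 1 = Fintype.card V + Fintype.card M) :
    Nat.card (BipTree d s) = Nat.card (Σ T : Hypertree V,
      {l : M ≃ T.edges // (∀ v, T.valency v = d v) ∧ ∀ j, (l j).1.card = s j}) := by
  symm
  refine Nat.card_eq_of_bijective (fun x => (⟨fun v j => decide (v ∈ (x.2.1 j).1), ?_, ?_, ?_⟩ :
    BipTree d s)) ⟨?_, ?_⟩
  · obtain ⟨T, l, -, -⟩ := x
    intro p hp
    simp only [decide_eq_true_eq] at hp
    have hV := T.edgeConnected (fun v => p (.inl v)) fun e he u hu v hv => by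
      obtain ⟨j, hj⟩ := l.surjective ⟨e, he⟩
      have hje : (l j).1 = e := congrArg Subtype.val hj
      exact (hp u j (hje ▸ hu)).trans (hp v j (hje ▸ hv)).symm
    have key : ∀ x, p x ↔ p (.inl (Classical.arbitrary V)) := by
      rintro (v | j)
      · exact hV _ _
      · obtain ⟨v, hv⟩ := Finset.card_pos.mp
          (zero_lt_two.trans_le (T.two_le_card _ (l j).2))
        exact (hp v j hv).symm.trans (hV _ _)
    exact fun x y => (key x).trans (key y).symm
  · obtain ⟨T, l, hd, -⟩ := x
    intro v
    rw [← hd v, Hypertree.valency, ← sum_toNat_decide,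
      ← Finset.sum_coe_sort T.edges fun e => (decide (v ∈ e)).toNat, ← Equiv.sum_comp l]
  · obtain ⟨T, l, -, hl⟩ := x
    intro j
    rw [sum_toNat_decide, ← hl j, Finset.filter_mem_eq_inter, Finset.univ_inter]
  · rintro ⟨T, l, hl⟩ ⟨T', l', hl'⟩ h
    have h1 : ∀ j, (l j).1 = (l' j).1 := fun j => by
      ext v
      have := congrFun (congrFun (congrArg Subtype.val h) v) j
      simpa using this
    obtain rfl : T = T' := by
      refine Hypertree.ext (Finset.ext fun e => ⟨fun he => ?_, fun he => ?_⟩)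
      · have := (l' (l.symm ⟨e, he⟩)).2
        rwa [← h1, Equiv.apply_symm_apply] at this
      · have := (l (l'.symm ⟨e, he⟩)).2
        rwa [h1, Equiv.apply_symm_apply] at this
    congr 1
    exact Subtype.ext (Equiv.ext fun j => Subtype.ext (h1 j))
  · rintro ⟨R, hR, hRd, hRs⟩
    set e : M → Finset V := fun j => Finset.univ.filter fun v => R v j = true with he
    have hcard : ∀ j, (e j).card = s j := fun j => by
      rw [← hRs j, ← sum_toNat_decide]
      exact Finset.sum_congr rfl fun v _ => by simp
    have hne : ∀ j, ∃ v, v ∈ e j := fun j => by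
      have := hs j
      exact Finset.card_pos.mp (by rw [hcard]; omega)
    choose r hr using hne
    have hc : ∀ p : V → Prop, (∀ j, ConstOn p (e j)) → ∀ u v, p u ↔ p v := by
      intro p hp u v
      refine hR (Sum.elim p fun j => p (r j)) (fun v j hvj => ?_) (.inl u) (.inl v)
      exact hp j v (by simpa [he] using hvj) (r j) (hr j)
    have hsum' : ∑ j, ((e j).card - 1) + 1 = Fintype.card V := by
      have := sum_sub_one_add_card fun j => one_le_two.trans (hs j)
      simp only [hcard]
      omega
    have ha := (acyclic_iff_sum_card hr hc).mpr hsum'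
    have hinj : Function.Injective e := by
      intro j k hjk
      by_contra hne
      obtain ⟨u, hu, v, hv, huv⟩ := Finset.one_lt_card.mp ((hcard j).symm ▸ hs j : 1 < (e j).card)
      obtain ⟨p, hp, hpe⟩ := ha j v hv
      exact huv ((hpe u hu).mp ((hp k (Ne.symm hne) u (hjk ▸ hu) v (hjk ▸ hv)).mpr
        ((hpe v hv).mpr rfl)))
    let T : Hypertree V := Hypertree.mk' (Finset.univ.image e)
      (fun f hf => by
        obtain ⟨j, -, rfl⟩ := Finset.mem_image.mp hf
        rw [hcard]
        exact hs j)
      (fun p hp => hc p fun j => hp _ (Finset.mem_image_of_mem e (Finset.mem_univ j)))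
      (fun f hf v hv => by
        obtain ⟨j, -, rfl⟩ := Finset.mem_image.mp hf
        obtain ⟨p, hp, hpe⟩ := ha j v hv
        refine ⟨p, fun f hf hfe => ?_, hpe⟩
        obtain ⟨k, -, rfl⟩ := Finset.mem_image.mp hf
        exact hp k fun h => hfe (h ▸ rfl))
    let l : M ≃ T.edges := Equiv.ofBijective
      (fun j => ⟨e j, Finset.mem_image_of_mem e (Finset.mem_univ j)⟩)
      ⟨fun j k h => hinj (congrArg Subtype.val h), fun ⟨f, hf⟩ => by
        obtain ⟨j, -, rfl⟩ := Finset.mem_image.mp hf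
        exact ⟨j, rfl⟩⟩
    have hl : ∀ j, (l j).1 = e j := fun j => rfl
    refine ⟨⟨T, l, fun v => ?_, hcard⟩, Subtype.ext (funext fun v => funext fun j => ?_)⟩
    · rw [← hRd v, Hypertree.valency, ← sum_toNat_decide,
        ← Finset.sum_coe_sort T.edges fun e => (decide (v ∈ e)).toNat, ← Equiv.sum_comp l]
      exact Finset.sum_congr rfl fun j _ => by simp [hl, he]
    · simp [hl, he]

end Labelled

theorem hasFibers_edges_iff {V : Type} {T : Hypertree V} {π : ℕ →₀ ℕ} :
    HasFibers (fun e : T.edges => e.1.card) π ↔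
      ∀ j, (T.edges.filter fun e => e.card = j).card = π j := by
  refine forall_congr' fun j => ?_
  rw [Finset.card_filter, Finset.card_filter,
    Finset.sum_coe_sort T.edges fun e => if e.card = j then 1 else 0]

/-- Counting the triples made of a hypertree, a permutation that sorts the valencies and a
numbering of the edges that sorts their sizes. -/
theorem hypertreeCount_mul {n : ℕ} (hn : 2 ≤ n) {α π : ℕ →₀ ℕ} (h : (α, π) ∈ indexSet n) :
    hypertreeCount n α π * ((∏ i ∈ α.support, (α i)!) * ∏ j ∈ π.support, (π j)!) *
      ((∏ i ∈ α.support, (i - 1)! ^ α i) * ∏ j ∈ π.support, (j - 1)! ^ π j) =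
      n ! * ((n - 1)! * ((π.sum fun _ b => b) - 1)!) := by
  classical
  obtain ⟨hα, hπ, hαn, hπn, hαπ⟩ := h
  obtain ⟨d, hd⟩ := HasFibers.exists_of_sum_eq hαn
  obtain ⟨s, hs⟩ := HasFibers.exists_of_sum_eq (c := π) rfl
  have : Nonempty (Fin n) := ⟨⟨0, by omega⟩⟩
  have hd1 : ∀ v, 1 ≤ d v := fun v => hα _ (hd.mem_support v)
  have hs2 : ∀ j, 2 ≤ s j := fun j => hπ _ (hs.mem_support j)
  have hsum_d : ∑ v, d v + 1 = n + π.sum fun _ b => b := by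
    rw [← hαπ, hd.sum_comp fun i => i]
    simp only [mul_comm]
  have hsum_s' : ∑ j, (s j - 1) + 1 = n := by
    rw [hs.sum_comp fun j => j - 1, ← hπn]
    simp only [mul_comm]
  have hsum_s : ∑ j, s j + 1 = n + π.sum fun _ b => b := by
    have := sum_sub_one_add_card fun j => one_le_two.trans (hs2 j)
    rw [Fintype.card_fin] at this
    omega
  have hM : Nonempty (Fin (π.sum fun _ b => b)) := by
    by_contra hM
    rw [not_nonempty_iff] at hM
    rw [Finset.univ_eq_empty, Finset.sum_empty] at hsum_s'
    omega
  -- the number of incidence graphs with prescribed degrees does not depend on the order of degrees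
  have hX : ∑ σ : Equiv.Perm (Fin n), Nat.card (BipTree (d ∘ σ) s) =
      hypertreeCount n α π * ((∏ i ∈ α.support, (α i)!) * ∏ j ∈ π.support, (π j)!) := by
    let _ : Fintype (Hypertree (Fin n)) := Fintype.ofFinite _
    have h1 : ∀ σ : Equiv.Perm (Fin n), Nat.card (BipTree (d ∘ σ) s) = _ := fun σ =>
      card_bipTree_eq_card_labelled hs2 (by simpa using hsum_s)
    rw [Finset.sum_congr rfl fun σ _ => h1 σ, ← Nat.card_sigma]
    let E : (Σ σ : Equiv.Perm (Fin n), Σ T : Hypertree (Fin n),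
        {l : Fin (π.sum fun _ b => b) ≃ T.edges //
          (∀ v, T.valency v = (d ∘ σ) v) ∧ ∀ j, (l j).1.card = s j}) ≃
        Σ T : Hypertree (Fin n), {σ : Equiv.Perm (Fin n) // ∀ v, d (σ v) = T.valency v} ×
          {l : Fin (π.sum fun _ b => b) ≃ T.edges // ∀ j, (l j).1.card = s j} :=
      { toFun := fun x => ⟨x.2.1, ⟨x.1, fun v => (x.2.2.2.1 v).symm⟩, ⟨x.2.2.1, x.2.2.2.2⟩⟩
        invFun := fun y => ⟨y.2.1.1, y.1, ⟨y.2.2.1, fun v => (y.2.1.2 v).symm, y.2.2.2⟩⟩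
        left_inv := fun _ => rfl
        right_inv := fun _ => rfl }
    rw [Nat.card_congr E, Nat.card_sigma, hypertreeCount, Nat.card_eq_fintype_card,
      Fintype.card_subtype, Finset.card_filter, Finset.sum_mul]
    refine Finset.sum_congr rfl fun T _ => ?_
    rw [Nat.card_prod]
    split_ifs with hT
    · rw [one_mul, HasFibers.card_equiv (f := fun v => T.valency v) hT.1 hd,
        HasFibers.card_equiv (g := fun e : T.edges => e.1.card) hs (hasFibers_edges_iff.mpr hT.2)]
    · rw [zero_mul, Nat.mul_eq_zero, Nat.card_eq_zero, Nat.card_eq_zero]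
      by_contra! hne
      obtain ⟨⟨⟨⟨σ, hσ⟩⟩, -⟩, ⟨⟨l, hl⟩⟩, -⟩ := hne
      refine hT ⟨hd.comp_equiv σ hσ, hasFibers_edges_iff.mp (hs.comp_equiv l.symm fun e => ?_)⟩
      rw [← hl, Equiv.apply_symm_apply]
  have hK := card_bipTree (n + π.sum fun _ b => b) (Fin n) (Fin (π.sum fun _ b => b)) d s (by simp)
    hd1 (fun j => one_le_two.trans (hs2 j)) hsum_d hsum_s
  rw [hd.prod_comp fun i => (i - 1)!, hs.prod_comp fun j => (j - 1)!, Fintype.card_fin,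
    Fintype.card_fin] at hK
  rw [← hX, Finset.sum_congr rfl fun σ _ => card_bipTree_comp_equiv σ d s, Finset.sum_const,
    Finset.card_univ, Fintype.card_perm, Fintype.card_fin, smul_eq_mul, mul_assoc, hK]

theorem hypertreeCount_eq_coefficient {n : ℕ} (hn : 2 ≤ n) {q : (ℕ →₀ ℕ) × (ℕ →₀ ℕ)}
    (h : q ∈ indexSet n) : (hypertreeCount n q.1 q.2 : ℚ) = coefficient n q.1 q.2 := by
  have h1 := congrArg (Nat.cast : ℕ → ℚ) (hypertreeCount_mul hn h)
  push_cast at h1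
  have hn0 : (n : ℚ) ≠ 0 := by positivity
  have hfac : (n : ℚ) * ((n - 1)! : ℚ) = (n ! : ℚ) := by
    exact_mod_cast Nat.mul_factorial_pred (by omega)
  rw [coefficient, Finset.prod_mul_distrib, Finset.prod_mul_distrib]
  have hp : ∀ (c : ℕ →₀ ℕ), (∏ i ∈ c.support, ((c i)! : ℚ)) ≠ 0 := fun c =>
    Finset.prod_ne_zero_iff.mpr fun i _ => by positivity
  have hp' : ∀ (c : ℕ →₀ ℕ), (∏ i ∈ c.support, ((i - 1)! : ℚ) ^ c i) ≠ 0 := fun c =>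
    Finset.prod_ne_zero_iff.mpr fun i _ => by positivity
  have := hp q.1
  have := hp q.2
  have := hp' q.1
  have := hp' q.2
  field_simp
  rw [← hfac] at h1 ⊢
  linear_combination (n : ℚ) * h1

theorem coefficient_pos {n : ℕ} (hn : 2 ≤ n) (α π : ℕ →₀ ℕ) : 0 < coefficient n α π := by
  have hp : ∀ (c : ℕ →₀ ℕ), 0 < ∏ i ∈ c.support, (((i - 1)! : ℚ) ^ c i * ((c i)! : ℚ)) :=
    fun c => Finset.prod_pos fun i _ => by positivity
  have := hp α
  have := hp π
  rw [coefficient]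
  positivity

end HypertreePosets

namespace HypertreePosets

/-! ### Isomorphism classes of products and of intervals of hypertree posets -/

/-- A product of order isomorphisms. -/
def orderIsoPiCongrRight {ι : Type} {A B : ι → Type} [∀ i, PartialOrder (A i)]
    [∀ i, PartialOrder (B i)] (F : ∀ i, A i ≃o B i) : (∀ i, A i) ≃o ∀ i, B i where
  toEquiv := Equiv.piCongrRight fun i => (F i).toEquiv
  map_rel_iff' := forall_congr' fun i => (F i).le_iff_le

/-- The partition poset as the dual of the poset of equivalence relations. -/
theorem nonempty_setoid_orderIso_partitionPoset {X : Type} {k : ℕ} (σ : X ≃ Fin k) :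
    Nonempty ((Setoid X)ᵒᵈ ≃o PartitionPoset k) := by
  classical
  have hpart : ∀ (P : Finpartition (Finset.univ : Finset (Fin k))) (a b : Fin k),
      a ∈ P.part b ↔ P.part a = P.part b := fun P a b =>
    P.mem_part_iff_part_eq_part (Finset.mem_univ a) (Finset.mem_univ b)
  let F : Finpartition (Finset.univ : Finset (Fin k)) ↪o Setoid X := OrderEmbedding.ofMapLEIff
    (fun P => (Setoid.ker P.part).comap σ) fun P Q => by
      refine ⟨fun h b hb => ?_, fun h x y hxy => ?_⟩
      · obtain ⟨a, ha⟩ := P.nonempty_of_mem_parts hb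
        refine ⟨Q.part a, Q.part_mem.mpr (Finset.mem_univ a), fun c hc => ?_⟩
        have hac : P.part (σ (σ.symm c)) = P.part (σ (σ.symm a)) := by
          rw [σ.apply_symm_apply, σ.apply_symm_apply, P.part_eq_of_mem hb hc,
            P.part_eq_of_mem hb ha]
        have h' : Q.part (σ (σ.symm c)) = Q.part (σ (σ.symm a)) := h hac
        rw [σ.apply_symm_apply, σ.apply_symm_apply] at h'
        exact (hpart Q c a).mpr h'
      · have hxy' : P.part (σ x) = P.part (σ y) := hxy
        obtain ⟨c, hc, hle⟩ := h (P.part_mem.mpr (Finset.mem_univ (σ y)))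
        have h₁ : σ x ∈ c := hle ((hpart P _ _).mpr hxy')
        have h₂ : σ y ∈ c := hle ((hpart P _ _).mpr rfl)
        exact (Q.part_eq_of_mem hc h₁).trans (Q.part_eq_of_mem hc h₂).symm
  have hF : Function.Surjective F := by
    intro s
    refine ⟨Finpartition.ofSetoid (s.comap σ.symm), ?_⟩
    ext x y
    change (Finpartition.ofSetoid _).part (σ x) = (Finpartition.ofSetoid _).part (σ y) ↔ _
    rw [← hpart, Finpartition.mem_part_ofSetoid_iff_rel, Setoid.comap_rel, σ.symm_apply_apply,
      σ.symm_apply_apply]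
    exact ⟨s.symm, s.symm⟩
  exact ⟨OrderIso.dual (OrderIso.symm (RelIso.ofSurjective F hF))⟩

namespace HTPoset

theorem toBHT_prod (P Q : HTPoset) : (P.prod Q).toBHT = P.toBHT * Q.toBHT :=
  map_mul (MonoidAlgebra.of ℚ HTClass) P.cls Q.cls

theorem toBHT_triv : triv.toBHT = 1 := map_one (MonoidAlgebra.of ℚ HTClass)

instance : Unique triv.1 := by
  have h : IsAtom (Finset.univ : Finset (Fin 1)) := by
    rw [Finset.univ_unique]
    exact Finset.isAtom_singleton _
  exact IsAtom.uniqueFinpartition (P := Finpartition.indiscrete h.1) h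

/-- The product of a finite family of posets of the hereditary family is isomorphic to a poset of
the hereditary family, and its class is the product of the classes. -/
theorem exists_pi (ι : Type) [Fintype ι] (Q : ι → HTPoset) :
    ∃ R : HTPoset, Nonempty (R.1 ≃o ∀ i, (Q i).1) ∧ R.toBHT = ∏ i, (Q i).toBHT := by
  refine Fintype.induction_empty_option (P := fun ι _ => ∀ Q : ι → HTPoset,
    ∃ R : HTPoset, Nonempty (R.1 ≃o ∀ i, (Q i).1) ∧ R.toBHT = ∏ i, (Q i).toBHT) ?_ ?_ ?_ ι Q
  · intro α β _ e ih Q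
    obtain ⟨R, ⟨F⟩, hR⟩ := ih fun a => Q (e a)
    let G : (∀ b, (Q b).1) ≃o ∀ a, (Q (e a)).1 :=
      { toEquiv := (Equiv.piCongrLeft (fun b => (Q b).1) e).symm
        map_rel_iff' := fun {f g} => e.forall_congr_right (q := fun b => f b ≤ g b) }
    refine ⟨R, ⟨F.trans G.symm⟩, hR.trans ?_⟩
    let _ := Fintype.ofEquiv β e.symm
    exact Equiv.prod_comp e fun b => (Q b).toBHT
  · intro Q
    refine ⟨triv, ⟨⟨⟨fun _ i => i.elim, fun _ => default, fun x => Subsingleton.elim _ _,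
      fun f => funext fun i => i.elim⟩, ?_⟩⟩, by simp [toBHT_triv]⟩
    intro x y
    exact ⟨fun _ => (Subsingleton.elim x y).le, fun _ i => i.elim⟩
  · intro α _ ih Q
    obtain ⟨R, ⟨F⟩, hR⟩ := ih fun a => Q (some a)
    refine ⟨(Q none).prod R, ⟨?_⟩, by rw [toBHT_prod, hR, Fintype.prod_option]⟩
    exact
      { toFun := fun x o => match o with
          | none => x.1
          | some a => F x.2 a
        invFun := fun f => (f none, F.symm fun a => f (some a))
        left_inv := fun x => Prod.ext rfl (F.symm_apply_apply x.2)
        right_inv := fun f => by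
          funext o
          rcases o with _ | a
          · rfl
          · exact congrFun (F.apply_symm_apply fun a => f (some a)) a
        map_rel_iff' := fun {x y} =>
          ⟨fun h => ⟨h none, F.le_iff_le.mp fun a => h (some a)⟩, fun h o => match o with
            | none => h.1
            | some a => F.le_iff_le.mpr h.2 a⟩ }

theorem toBHT_eq_prod {ι : Type} [Fintype ι] {P : HTPoset} {Q : ι → HTPoset}
    (F : P.1 ≃o ∀ i, (Q i).1) : P.toBHT = ∏ i, (Q i).toBHT := by
  obtain ⟨R, ⟨G⟩, hR⟩ := exists_pi ι Q
  rw [← hR]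
  exact toBHT_eq ⟨F.trans G.symm⟩

end HTPoset

theorem partitionClass_one : partitionClass 1 = 1 := HTPoset.toBHT_triv

theorem comul_toBHT (P : HTPoset) :
    comul P.toBHT = ∑ x : P.1, (P.lower x).toBHT ⊗ₜ[ℚ] (P.upper x).toBHT := by
  have : comul P.toBHT = comulClass P.cls := by
    simp [comul, HTPoset.toBHT]
  rw [this]
  rfl

/-- The hypertree poset as a poset of the hereditary family. -/
noncomputable abbrev HTPoset.hypertree (n : ℕ) : HTPoset :=
  ⟨bundle (HypertreePoset n), .hypertree n⟩

/-- The lower intervals of a hypertree poset are products of partition posets. -/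
theorem toBHT_lower_hypertree {n : ℕ} (T : HypertreePoset n) :
    ((HTPoset.hypertree n).lower T).toBHT = ∏ v, partitionClass (T.valency v) := by
  obtain ⟨F⟩ := Hypertree.nonempty_Iic_orderIso T
  have G := fun v => Classical.choice
    (nonempty_setoid_orderIso_partitionPoset (T.edges.filter (v ∈ ·)).equivFin)
  let H : ((HTPoset.hypertree n).lower T).1 ≃o Set.Iic T :=
    { toFun := fun S => ⟨S.1, S.2.2⟩
      invFun := fun S => ⟨S.1, (HTPoset.hypertree n).bot_le _, S.2⟩
      left_inv := fun _ => rfl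
      right_inv := fun _ => rfl
      map_rel_iff' := Iff.rfl }
  exact HTPoset.toBHT_eq_prod
    (Q := fun v => ⟨bundle (PartitionPoset (T.valency v)), .partition _⟩)
    ((H.trans F).trans (orderIsoPiCongrRight G))

/-- The upper sets of a hypertree poset are products of hypertree posets. -/
theorem toBHT_upper_hypertree {n : ℕ} (T : HypertreePoset n) :
    ((HTPoset.hypertree n).upper T).toBHT = ∏ e : T.edges, hypertreeClass e.1.card := by
  obtain ⟨F⟩ := Hypertree.nonempty_Ici_orderIso (T := T) (W := fun e => Fin e.1.card)
    (ι := fun e => (e.1.orderEmbOfFin rfl).toEmbedding) fun e => e.1.map_orderEmbOfFin_univ rfl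
  exact HTPoset.toBHT_eq_prod
    (P := (HTPoset.hypertree n).upper T)
    (Q := fun e : T.edges => ⟨bundle (HypertreePoset e.1.card), .hypertree _⟩) F

end HypertreePosets

namespace HypertreePosets

/-! ### The coproduct of the hypertree posets -/

theorem HasFibers.exists_finsupp {A : Type} [Fintype A] (f : A → ℕ) : ∃ c, HasFibers f c := by
  refine ⟨(Finset.univ.val.map f).toFinsupp, fun i => ?_⟩
  rw [Multiset.toFinsupp_apply, Multiset.count_map, Finset.card_def, Finset.filter_val]
  simp only [eq_comm]

theorem HasFibers.unique {A : Type} [Fintype A] {f : A → ℕ} {c c' : ℕ →₀ ℕ} (h : HasFibers f c)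
    (h' : HasFibers f c') : c = c' := Finsupp.ext fun i => (h i).symm.trans (h' i)

namespace Hypertree

variable {n : ℕ} {T : HypertreePoset n}

/-- Double counting of the incidences of vertices and edges. -/
theorem sum_valency (T : HypertreePoset n) : ∑ v, T.valency v = ∑ e ∈ T.edges, e.card := by
  simp only [valency, Finset.card_filter]
  rw [Finset.sum_comm]
  refine Finset.sum_congr rfl fun e _ => ?_
  rw [← Finset.card_filter, Finset.filter_mem_eq_inter, Finset.univ_inter]

theorem mem_indexSet (hn : 2 ≤ n) {α π : ℕ →₀ ℕ} (hα : HasFibers (fun v => T.valency v) α)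
    (hπ : HasFibers (fun e : T.edges => e.1.card) π) : (α, π) ∈ indexSet n := by
  classical
  have hne : Nonempty (Fin n) := ⟨⟨0, by omega⟩⟩
  have hntr : Nontrivial (Fin n) := Fin.nontrivial_iff_two_le.mpr hn
  have hcard := T.sum_card_sub_one
  have hval := T.sum_valency
  rw [Fintype.card_fin] at hcard
  rw [← Finset.sum_coe_sort T.edges] at hcard hval
  have hsum := sum_sub_one_add_card fun e : T.edges => one_le_two.trans (T.two_le_card e.1 e.2)
  refine ⟨fun i hi => ?_, fun j hj => ?_, ?_, ?_, ?_⟩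
  · rw [← hα.image_eq_support] at hi
    obtain ⟨v, -, rfl⟩ := Finset.mem_image.mp hi
    obtain ⟨u, hu⟩ := exists_ne v
    obtain ⟨e, he, hve⟩ := T.exists_edge_of_ne hu.symm
    exact Finset.card_pos.mpr ⟨e, Finset.mem_filter.mpr ⟨he, hve⟩⟩
  · rw [← hπ.image_eq_support] at hj
    obtain ⟨e, -, rfl⟩ := Finset.mem_image.mp hj
    exact T.two_le_card e.1 e.2
  · exact hα.card_eq.symm.trans (Fintype.card_fin n)
  · rw [hπ.sum_comp fun j => j - 1] at hcard
    rw [← hcard]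
    simp only [mul_comm]
  · rw [hπ.card_eq] at hsum
    rw [hα.sum_comp fun i => i] at hval
    have : (α.sum fun i a => i * a) = α.sum fun i a => a * i := by simp only [mul_comm]
    change (α.sum fun i a => i * a) + 1 = n + π.sum fun _ b => b
    omega

end Hypertree

theorem prod_partitionClass {A : Type} [Fintype A] {f : A → ℕ} {c : ℕ →₀ ℕ} (h : HasFibers f c)
    (hc : ∀ i ∈ c.support, 1 ≤ i) :
    ∏ a, partitionClass (f a) = ∏ i ∈ c.support with 2 ≤ i, partitionClass i ^ c i := by
  rw [h.prod_comp, Finset.prod_filter_of_ne]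
  intro i hi hne
  by_contra hi2
  obtain rfl : i = 1 := by have := hc i hi; omega
  exact hne (by rw [partitionClass_one, one_pow])

end HypertreePosets
open HypertreePosets in
theorem mainTheorem4 (n : ℕ) (hn : 2 ≤ n) :
    ∃ hfin : (indexSet n).Finite,
      comul (hypertreeClass n) = ∑ q ∈ hfin.toFinset, coefficient n q.1 q.2 •
        ((∏ i ∈ q.1.support with 2 ≤ i, partitionClass i ^ q.1 i) ⊗ₜ[ℚ]
          ∏ j ∈ q.2.support, hypertreeClass j ^ q.2 j) ∧
      ∀ q ∈ indexSet n, (hypertreeCount n q.1 q.2 : ℚ) = coefficient n q.1 q.2 := by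
  classical
  let _ : Fintype (HypertreePoset n) := Fintype.ofFinite _
  choose α hα using fun T : HypertreePoset n => HasFibers.exists_finsupp fun v => T.valency v
  choose π hπ using fun T : HypertreePoset n =>
    HasFibers.exists_finsupp fun e : T.edges => e.1.card
  have hcoeff := fun q (hq : q ∈ indexSet n) => hypertreeCount_eq_coefficient hn hq
  have hmem : ∀ T, (α T, π T) ∈ indexSet n := fun T => T.mem_indexSet hn (hα T) (hπ T)
  have htype : ∀ T q, (α T, π T) = q ↔
      (∀ i, (Finset.univ.filter fun v => T.valency v = i).card = q.1 i) ∧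
      ∀ j, (T.edges.filter fun e => e.card = j).card = q.2 j := by
    rintro T ⟨a, b⟩
    rw [Prod.mk.injEq, ← hasFibers_edges_iff]
    exact ⟨fun ⟨h₁, h₂⟩ => ⟨h₁ ▸ hα T, h₂ ▸ hπ T⟩,
      fun ⟨h₁, h₂⟩ => ⟨(hα T).unique h₁, (hπ T).unique h₂⟩⟩
  have hcount : ∀ q, (Finset.univ.filter fun T => (α T, π T) = q).card =
      hypertreeCount n q.1 q.2 := fun q => by
    rw [hypertreeCount, Nat.card_eq_fintype_card, Fintype.card_subtype]
    simp only [htype]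
  -- as the coefficients do not vanish, every element of the index set comes from a hypertree
  have himage : (indexSet n) = ↑(Finset.univ.image fun T => (α T, π T)) := by
    ext q
    simp only [Finset.coe_image, Finset.coe_univ, Set.image_univ, Set.mem_range]
    refine ⟨fun hq => ?_, fun ⟨T, hT⟩ => hT ▸ hmem T⟩
    have hpos : 0 < (hypertreeCount n q.1 q.2 : ℚ) := hcoeff q hq ▸ coefficient_pos hn q.1 q.2
    rw [Nat.cast_pos, ← hcount, Finset.card_pos] at hpos
    obtain ⟨T, hT⟩ := hpos
    exact ⟨T, (Finset.mem_filter.mp hT).2⟩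
  have hfin : (indexSet n).Finite := himage ▸ Finset.finite_toSet _
  refine ⟨hfin, ?_, hcoeff⟩
  have hfinset : hfin.toFinset = Finset.univ.image fun T => (α T, π T) := by
    rw [← Finset.coe_inj, hfin.coe_toFinset, himage]
  let F : (ℕ →₀ ℕ) × (ℕ →₀ ℕ) → BHT ⊗[ℚ] BHT := fun q =>
    (∏ i ∈ q.1.support with 2 ≤ i, partitionClass i ^ q.1 i) ⊗ₜ[ℚ]
      ∏ j ∈ q.2.support, hypertreeClass j ^ q.2 j
  have hterm : ∀ T : HypertreePoset n, ((HTPoset.hypertree n).lower T).toBHT ⊗ₜ[ℚ]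
      ((HTPoset.hypertree n).upper T).toBHT = F (α T, π T) := fun T => by
    rw [toBHT_lower_hypertree, toBHT_upper_hypertree, prod_partitionClass (hα T) (hmem T).1,
      (hπ T).prod_comp]
  calc comul (hypertreeClass n)
      = ∑ T : HypertreePoset n, ((HTPoset.hypertree n).lower T).toBHT ⊗ₜ[ℚ]
          ((HTPoset.hypertree n).upper T).toBHT := by
        rw [hypertreeClass, comul_toBHT]
    _ = _ := by
        rw [Finset.sum_congr rfl fun T _ => hterm T, Finset.sum_comp F fun T => (α T, π T), hfinset]
        refine Finset.sum_congr rfl fun q hq => ?_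
        rw [← hfinset, hfin.mem_toFinset] at hq
        rw [hcount, ← hcoeff q hq, Nat.cast_smul_eq_nsmul]
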